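/- A \emph{counting process} is a stochastic process $N=(N(t))_{t\in[0,\infty)}$ with values in $\{0,1,2,\dots\}$ whose sample paths are non-decreasing, right-continuous with left limits, and satisfy $N(0)=0$; put $N(\infty)=\lim_{t\to\infty}N(t)$. For a function $f\colon[0,\infty)\to\mathbb{R}$ and $p\ge 1$ let $$v_p(f)=\sup\Big\{\sum_{j=1}^m|f(t_j)-f(t_{j-1})|^p : m\in\mathbb{N},\ 0\le t_0\le t_1\le\dots\le t_m<\infty\Big\},\qquad \|f\|_{[p]}=v_p(f)^{1/p}+\sup_{t\ge 0}|f(t)|.$$ \textbf{Theorem.} Let $p\in[1,2)$ and $B>0$. There is a constant $\lambda=\lambda(p,B)\in[0,\infty)$, depending only on $p$ and $B$, such that the following holds. Let $N$ be a counting process with $N(\infty)\le B$ almost surely and mean function $F(t)=\operatorname{E}(N(t))$, let $N_1,N_2,\dots$ be independent replications of $N$ (independent counting processes with the same law as $N$), and let $F_n=n^{-1}\sum_{i=1}^n N_i$. Then, almost surely, $\|F_n-F\|_{[p]}<\infty$ for all $n$ and $$\limsup_{n\to\infty} n^{(p-1)/p}\,\|F_n-F\|_{[p]}\le\lambda .$$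 In particular, $\|F_n-F\|_{[p]}=O(n^{(1-p)/p})$ almost surely. -/

import Mathlib

open MeasureTheory ProbabilityTheory Filter Topology Asymptotics
open scoped NNReal ENNReal

noncomputable section

namespace CountingProcess

/-- The `p`-variation `v_p(f) = sup ∑ |f (t_j) - f (t_{j-1})| ^ p` of a real function on a linearly
ordered set `T` (an interval), the supremum being over all `m` and all `t_0 ≤ t_1 ≤ ⋯ ≤ t_m`
in `T`. It takes values in `[0, ∞]`. -/
def pVariation {T : Type*} [LinearOrder T] (p : ℝ) (f : T → ℝ) : ℝ≥0∞ :=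
  ⨆ (m : ℕ) (t : {t : ℕ → T // Monotone t}),
    ∑ j ∈ Finset.range m, ENNReal.ofReal (|f (t.1 (j + 1)) - f (t.1 j)| ^ p)

/-- The supremum norm, with values in `[0, ∞]`. -/
def supNorm {T : Type*} (f : T → ℝ) : ℝ≥0∞ :=
  ⨆ t : T, ENNReal.ofReal |f t|

/-- The `p`-variation norm `‖f‖_[p] = v_p(f) ^ (1 / p) + ‖f‖_∞`, with values in `[0, ∞]`. -/
def pVarNorm {T : Type*} [LinearOrder T] (p : ℝ) (f : T → ℝ) : ℝ≥0∞ :=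
  pVariation p f ^ (1 / p) + supNorm f

/-- `N` is a counting process: `N t` is a random variable with values in `{0, 1, 2, …}` for every
`t ∈ [0, ∞)`, and all sample paths are increasing, right-continuous with left limits, and start
at `0`. The value at time `∞` is not a separate datum: it is the limit `terminalValue N`. -/
structure IsCountingProcess {Ω : Type*} [MeasurableSpace Ω] (N : ℝ≥0 → Ω → ℕ) : Prop where
  measurable : ∀ t, Measurable (N t)
  zero : ∀ ω, N 0 ω = 0
  mono : ∀ ω, Monotone fun t => N t ω
  right_continuous : ∀ ω t, ContinuousWithinAt (fun s => N s ω) (Set.Ici t) t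
  left_limits : ∀ ω t, ∃ l : ℕ, Tendsto (fun s => N s ω) (𝓝[<] t) (𝓝 l)

/-- `N(∞)`, the limit of the increasing path `t ↦ N(t)` as `t → ∞`, in `[0, ∞]`. -/
def terminalValue {Ω : Type*} (N : ℝ≥0 → Ω → ℕ) (ω : Ω) : ℝ≥0∞ :=
  ⨆ t : ℝ≥0, (N t ω : ℝ≥0∞)

theorem IsCountingProcess.tendsto_terminalValue {Ω : Type*} [MeasurableSpace Ω]
    {N : ℝ≥0 → Ω → ℕ} (hN : IsCountingProcess N) (ω : Ω) :
    Tendsto (fun t => (N t ω : ℝ≥0∞)) atTop (𝓝 (terminalValue N ω)) :=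
  tendsto_atTop_iSup fun _ _ h => Nat.cast_le.2 (hN.mono ω h)

/-- The mean function `F(t) = E(N(t))`. -/
def meanFunction {Ω : Type*} [MeasurableSpace Ω] (μ : Measure Ω) (N : ℝ≥0 → Ω → ℕ)
    (t : ℝ≥0) : ℝ :=
  ∫ ω, (N t ω : ℝ) ∂μ

/-- The average `F_n(t) = n⁻¹ ∑ N_i(t)` of the first `n` processes of a sequence. -/
def empiricalMean {Ω : Type*} (M : ℕ → ℝ≥0 → Ω → ℕ) (n : ℕ) (ω : Ω) (t : ℝ≥0) : ℝ :=
  (n : ℝ)⁻¹ * ∑ i ∈ Finset.range n, (M i t ω : ℝ)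

/-- The sequence `M 0, M 1, …` on `(Ω', μ')` consists of independent replications of the counting
process `N` on `(Ω, μ)`: counting processes that are independent, each with the law of `N`
(as random elements of the space of paths with the product σ-algebra). -/
structure IsReplicationSequence {Ω Ω' : Type*} [MeasurableSpace Ω] [MeasurableSpace Ω']
    (μ : Measure Ω) (N : ℝ≥0 → Ω → ℕ) (μ' : Measure Ω') (M : ℕ → ℝ≥0 → Ω' → ℕ) : Prop where
  isCountingProcess : ∀ i, IsCountingProcess (M i)
  indep : iIndepFun (fun (i : ℕ) (ω : Ω') (t : ℝ≥0) => M i t ω) μ'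
  identDistrib : ∀ i, IdentDistrib (fun (ω : Ω') (t : ℝ≥0) => M i t ω)
    (fun (ω : Ω) (t : ℝ≥0) => N t ω) μ' μ

end CountingProcess

end

/-! Write `F_n - F` as `1/n` times a centred sum of monotone bounded paths; the claim is that the
`p`-variation of this sum, to the power `1/p`, is `O(n^(1/p))`. Choose about `n` quantile cells of
the mean function, so that `n F` grows by a bounded amount on each.

Inside cells, the sum and its mean are both monotone, so their `p`-variation is governed by their
increments over whole cells (`lpSum_cells_le`). For `n F` these contribute at most a constant times
`n^(1/p)`; for the sum they differ from those of `n F` by increments of the centred sum between cell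
endpoints. At the endpoints, dyadic chaining bounds the `p`-variation by `dyadicNorm`, the sum over
levels of `ℓ^p` norms of dyadic increments (`lpSum_increments_le_dyadic`). Hence only `dyadicNorm`
is random (`lpSum_increments_le`).

Its mean: the `ℓ^2` norm of the increments at any level has mean at most `K √n`, by independence and
telescoping of variances. Passing to `ℓ^p` costs `(2^k)^(1/p - 1/2)` at level `k`. As `p < 2` this
grows geometrically, the finest level `2^k ≈ n` dominates, and the total is of order `n^(1/p)`
(`integral_dyadicNorm_le`).

Its fluctuations: replacing one path moves `dyadicNorm` by `O(log n)`, so bounded differences give a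
deviation probability at `n^(1/p)` of about `exp(-n^(2/p - 1) / log² n)`, which is summable. The
bound is the same for every time grid; refining grids and right-continuity extend it to `[0, ∞)`,
and Borel–Cantelli concludes (`ae_eventually_pVarNorm_le`). -/

namespace CountingProcess

/-! ### Finite `ℓ^p` norms -/

/-- The `ℓ^p` norm of the first `m` terms of a real sequence. -/
noncomputable def lpSum (p : ℝ) (m : ℕ) (x : ℕ → ℝ) : ℝ :=
  (∑ i ∈ Finset.range m, |x i| ^ p) ^ (1 / p)

theorem lpSum_nonneg (p : ℝ) (m : ℕ) (x : ℕ → ℝ) : 0 ≤ lpSum p m x :=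
  Real.rpow_nonneg (Finset.sum_nonneg fun _ _ => Real.rpow_nonneg (abs_nonneg _) _) _

theorem lpSum_add_le {p : ℝ} (hp : 1 ≤ p) (m : ℕ) (x y : ℕ → ℝ) :
    lpSum p m (fun i => x i + y i) ≤ lpSum p m x + lpSum p m y :=
  Real.Lp_add_le _ x y hp

theorem lpSum_mono {p : ℝ} (hp : 1 ≤ p) {m m' : ℕ} {x y : ℕ → ℝ}
    (h : ∑ i ∈ Finset.range m, |x i| ^ p ≤ ∑ i ∈ Finset.range m', |y i| ^ p) :
    lpSum p m x ≤ lpSum p m' y :=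
  Real.rpow_le_rpow (Finset.sum_nonneg fun _ _ => Real.rpow_nonneg (abs_nonneg _) _) h
    (by positivity)

theorem lpSum_le_two_mul {p : ℝ} (hp : 1 ≤ p) {m m' : ℕ} {x y : ℕ → ℝ}
    (h : ∑ i ∈ Finset.range m, |x i| ^ p ≤ 2 ^ p * ∑ i ∈ Finset.range m', |y i| ^ p) :
    lpSum p m x ≤ 2 * lpSum p m' y := by
  have h0 : 0 ≤ ∑ i ∈ Finset.range m', |y i| ^ p :=
    Finset.sum_nonneg fun _ _ => Real.rpow_nonneg (abs_nonneg _) _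
  have := Real.rpow_le_rpow (Finset.sum_nonneg fun _ _ => Real.rpow_nonneg (abs_nonneg _) _) h
    (by positivity : 0 ≤ 1 / p)
  rw [Real.mul_rpow (by positivity) h0, ← Real.rpow_mul (by norm_num),
    mul_one_div_cancel (by positivity), Real.rpow_one] at this
  exact this

theorem lpSum_sub_le {p : ℝ} (hp : 1 ≤ p) (m : ℕ) (x y : ℕ → ℝ) :
    |lpSum p m x - lpSum p m y| ≤ lpSum p m (fun i => x i - y i) := by
  have h1 := lpSum_add_le hp m (fun i => x i - y i) y
  have h2 := lpSum_add_le hp m (fun i => y i - x i) x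
  have h3 : lpSum p m (fun i => y i - x i) = lpSum p m (fun i => x i - y i) := by
    simp only [lpSum, abs_sub_comm]
  simp only [sub_add_cancel] at h1 h2
  rw [abs_le]; constructor <;> linarith

theorem sum_rpow_le_rpow_sum {p : ℝ} (hp : 1 ≤ p) (m : ℕ) (x : ℕ → ℝ) (hx : ∀ i, 0 ≤ x i) :
    ∑ i ∈ Finset.range m, x i ^ p ≤ (∑ i ∈ Finset.range m, x i) ^ p := by
  induction m with
  | zero => simp [Real.zero_rpow (by positivity : p ≠ 0)]
  | succ m ih =>
    rw [Finset.sum_range_succ, Finset.sum_range_succ]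
    exact (add_le_add_left ih _).trans
      (Real.add_rpow_le_rpow_add (Finset.sum_nonneg fun i _ => hx i) (hx m) hp)

theorem lpSum_le_sum_abs {p : ℝ} (hp : 1 ≤ p) (m : ℕ) (x : ℕ → ℝ) :
    lpSum p m x ≤ ∑ i ∈ Finset.range m, |x i| := by
  have h := Real.rpow_le_rpow (Finset.sum_nonneg fun _ _ => Real.rpow_nonneg (abs_nonneg _) _)
    (sum_rpow_le_rpow_sum hp m (fun i => |x i|) fun _ => abs_nonneg _) (by positivity : 0 ≤ 1 / p)
  rwa [← Real.rpow_mul (Finset.sum_nonneg fun _ _ => abs_nonneg _),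
    mul_one_div_cancel (by positivity), Real.rpow_one] at h

/-- The power mean inequality between exponents `p ≤ 2` and `2`. -/
theorem lpSum_le_sqrt {p : ℝ} (hp : 1 ≤ p) (hp2 : p ≤ 2) (m : ℕ) (x : ℕ → ℝ) :
    lpSum p m x ≤ (m : ℝ) ^ (1 / p - 1 / 2) * √(∑ i ∈ Finset.range m, x i ^ 2) := by
  have hp0 : 0 < p := by positivity
  have h := Real.rpow_sum_le_const_mul_sum_rpow (Finset.range m) (fun i => |x i| ^ p)
    (p := 2 / p) (by rw [le_div_iff₀ hp0]; linarith)
  have e1 : ∀ i, |(|x i| ^ p)| = |x i| ^ p := fun i => abs_of_nonneg (by positivity)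
  have e2 : ∀ i, (|x i| ^ p) ^ (2 / p) = x i ^ 2 := fun i => by
    rw [← Real.rpow_mul (abs_nonneg _), mul_div_cancel₀ _ hp0.ne']
    norm_num
  simp only [e1, e2, Finset.card_range] at h
  have h0 : 0 ≤ ∑ i ∈ Finset.range m, |x i| ^ p := Finset.sum_nonneg fun _ _ => by positivity
  have h' := Real.rpow_le_rpow (by positivity) h (by norm_num : (0 : ℝ) ≤ 1 / 2)
  rw [← Real.rpow_mul h0, Real.mul_rpow (by positivity)
    (Finset.sum_nonneg fun _ _ => by positivity), ← Real.rpow_mul (by positivity),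
    ← Real.sqrt_eq_rpow] at h'
  have e3 : 2 / p * (1 / 2) = 1 / p := by ring
  have e4 : (2 / p - 1) * (1 / 2) = 1 / p - 1 / 2 := by ring
  rwa [e3, e4] at h'

theorem lpSum_le_of_abs_le {p : ℝ} (hp : 1 ≤ p) (m : ℕ) {x : ℕ → ℝ} {c : ℝ}
    (h : ∀ i, |x i| ≤ c) : lpSum p m x ≤ (m : ℝ) ^ (1 / p) * c := by
  have hc : 0 ≤ c := (abs_nonneg _).trans (h 0)
  have h1 : ∑ i ∈ Finset.range m, |x i| ^ p ≤ m * c ^ p := by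
    refine (Finset.sum_le_sum fun i _ => Real.rpow_le_rpow (abs_nonneg _) (h i)
      (by positivity)).trans ?_
    simp
  have := Real.rpow_le_rpow (Finset.sum_nonneg fun _ _ => Real.rpow_nonneg (abs_nonneg _) _) h1
    (by positivity : 0 ≤ 1 / p)
  rwa [Real.mul_rpow (by positivity) (by positivity), ← Real.rpow_mul hc,
    mul_one_div_cancel (by positivity), Real.rpow_one] at this

theorem measurable_lpSum (p : ℝ) (m : ℕ) : Measurable (lpSum p m) := by
  unfold lpSum; fun_prop

theorem abs_sub_rpow_le {p : ℝ} (hp : 1 ≤ p) (a b : ℝ) :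
    |a - b| ^ p ≤ 2 ^ (p - 1) * (|a| ^ p + |b| ^ p) := by
  have h := Real.rpow_sum_le_const_mul_sum_rpow (Finset.range 2)
    (fun i => if i = 0 then a else b) hp
  simp only [Finset.sum_range_succ, Finset.sum_range_zero, Finset.card_range] at h
  norm_num at h
  exact (Real.rpow_le_rpow (abs_nonneg _) (abs_sub a b) (by positivity)).trans h

/-! ### Deterministic `p`-variation estimates: chaining and cells -/

/-- The increments of a function along an increasing sequence, controlled by its values. -/
theorem sum_abs_sub_rpow_le {p : ℝ} (hp : 1 ≤ p) (r : ℕ → ℝ) (n m : ℕ) (t : ℕ → ℕ)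
    (ht : Monotone t) (htn : ∀ j, t j ≤ n) :
    ∑ j ∈ Finset.range m, |r (t (j + 1)) - r (t j)| ^ p
      ≤ 2 ^ p * ∑ i ∈ Finset.range (n + 1), |r i| ^ p := by
  set y : ℕ → ℝ := fun i => |r i| ^ p
  have hy : ∀ i, 0 ≤ y i := fun i => by positivity
  set P : ℕ → ℝ := fun a => ∑ i ∈ Finset.range a, y i with hP
  have hPm : Monotone P := fun a b h => Finset.sum_le_sum_of_subset_of_nonneg
    (Finset.range_mono h) fun i _ _ => hy i
  have hP0 : ∀ a, 0 ≤ P a := fun a => Finset.sum_nonneg fun i _ => hy i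
  have hPs : ∀ a, P (a + 1) = P a + y a := fun a => Finset.sum_range_succ _ _
  -- Each index serves at most once as a left and once as a right endpoint of a nontrivial step. The
  -- potential `P a + P (a + 1)` encodes this: it rises by at least `y (t j) + y (t (j + 1))`
  -- whenever `t` moves.
  have key : ∀ j, |r (t (j + 1)) - r (t j)| ^ p
      ≤ 2 ^ (p - 1) * ((P (t (j + 1)) + P (t (j + 1) + 1)) - (P (t j) + P (t j + 1))) := by
    intro j
    rcases (ht (Nat.le_succ j)).eq_or_lt with h | h
    · rw [← h]; simp [Real.zero_rpow (by positivity : p ≠ 0)]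
    · refine (abs_sub_rpow_le hp _ _).trans (mul_le_mul_of_nonneg_left ?_ (by positivity))
      have h1 := hPm (Nat.succ_le_of_lt h)
      have h2 := hPs (t j)
      have h3 := hPs (t (j + 1))
      simp only [Nat.succ_eq_add_one] at h1
      show y _ + y _ ≤ _
      linarith [hPs (t j)]
  refine (Finset.sum_le_sum fun j _ => key j).trans ?_
  rw [← Finset.mul_sum, Finset.sum_range_sub (fun j => P (t j) + P (t j + 1))]
  have h1 := hPm ((htn m).trans n.le_succ)
  have h2 := hPm (Nat.succ_le_succ (htn m))
  have e : (2 : ℝ) ^ p = 2 ^ (p - 1) * 2 := by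
    rw [Real.rpow_sub_one (by norm_num)]; ring
  rw [e, mul_assoc]
  refine mul_le_mul_of_nonneg_left ?_ (by positivity)
  have := hP0 (t 0); have := hP0 (t 0 + 1)
  simp only [Nat.succ_eq_add_one] at h1 h2
  show _ ≤ 2 * P (n + 1)
  linarith

/-- The `p`-variation of a sequence on `{0, …, 2 ^ L}` is controlled by its dyadic increments. -/
theorem lpSum_increments_le_dyadic {p : ℝ} (hp : 1 ≤ p) (m L : ℕ) (f : ℕ → ℝ) (t : ℕ → ℕ)
    (ht : Monotone t) (htL : ∀ j, t j ≤ 2 ^ L) :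
    lpSum p m (fun j => f (t (j + 1)) - f (t j)) ≤
      2 * ∑ k ∈ Finset.range (L + 1),
        lpSum p (2 ^ k) (fun i => f ((i + 1) * 2 ^ (L - k)) - f (i * 2 ^ (L - k))) := by
  induction L generalizing f t with
  | zero =>
    have h := sum_abs_sub_rpow_le hp (fun i => f i - f 0) 1 m t ht (by simpa using htL)
    have h' : ∑ i ∈ Finset.range 2, |f i - f 0| ^ p
        = ∑ i ∈ Finset.range 1, |f (i + 1) - f i| ^ p := by
      simp [Finset.sum_range_succ, Real.zero_rpow (by positivity : p ≠ 0)]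
    simp only [sub_sub_sub_cancel_right] at h
    rw [h'] at h
    simpa using lpSum_le_two_mul hp h
  | succ L ih =>
    -- Rounding down to even indices leaves a function on the coarser grid, handled by induction,
    -- and the remainder `r`. The latter vanishes at even indices and is a finest-level increment at
    -- odd ones.
    set r : ℕ → ℝ := fun i => f i - f (2 * (i / 2)) with hr
    have h1 := ih (fun i => f (2 * i)) (fun j => t j / 2)
      (fun a b h => Nat.div_le_div_right (ht h))
      (fun j => by have := htL j; rw [pow_succ] at this; omega)
    have hy : ∑ i ∈ Finset.range (2 ^ (L + 1) + 1), |r i| ^ p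
        ≤ ∑ i ∈ Finset.range (2 ^ (L + 1)), |f (i + 1) - f i| ^ p := by
      rw [Finset.sum_range_succ']
      have : |r 0| ^ p = 0 := by simp [hr, Real.zero_rpow (by positivity : p ≠ 0)]
      rw [this, add_zero]
      refine Finset.sum_le_sum fun i _ => ?_
      rcases Nat.even_or_odd' i with ⟨c, rfl | rfl⟩
      · have : 2 * ((2 * c + 1) / 2) = 2 * c := by omega
        simp only [hr, this]; rfl
      · have : 2 * ((2 * c + 1 + 1) / 2) = 2 * c + 1 + 1 := by omega
        simp only [hr, this, sub_self, abs_zero, Real.zero_rpow (by positivity : p ≠ 0)]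
        positivity
    have h2 := lpSum_le_two_mul hp ((sum_abs_sub_rpow_le hp r _ m t ht htL).trans
      (mul_le_mul_of_nonneg_left hy (by positivity)))
    have h3 := lpSum_add_le hp m
      (fun j => f (2 * (t (j + 1) / 2)) - f (2 * (t j / 2))) (fun j => r (t (j + 1)) - r (t j))
    have e : (fun j => f (2 * (t (j + 1) / 2)) - f (2 * (t j / 2)) + (r (t (j + 1)) - r (t j)))
        = fun j => f (t (j + 1)) - f (t j) := by
      funext j; simp only [hr]; ring
    rw [e] at h3
    rw [Finset.sum_range_succ, mul_add]
    have e2 : ∀ k ∈ Finset.range (L + 1),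
        lpSum p (2 ^ k) (fun i => f ((i + 1) * 2 ^ (L + 1 - k)) - f (i * 2 ^ (L + 1 - k)))
        = lpSum p (2 ^ k)
          (fun i => f (2 * ((i + 1) * 2 ^ (L - k))) - f (2 * (i * 2 ^ (L - k)))) := by
      intro k hk
      have hk' : k ≤ L := Nat.lt_succ_iff.1 (Finset.mem_range.1 hk)
      rw [Nat.sub_add_comm hk', pow_succ]
      congr 1; funext i; congr 2 <;> ring
    rw [Finset.sum_congr rfl e2]
    simp only [Nat.sub_self, pow_zero, mul_one]
    linarith

/-- The `p`-variation of a nonnegative function that increases on each cell of an ordered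
partition. -/
theorem sum_abs_sub_rpow_le_cells {p : ℝ} (hp : 1 ≤ p) (m J : ℕ) (y : ℕ → ℝ) (c : ℕ → ℕ)
    (D : ℕ → ℝ) (hc : Monotone c) (hcJ : ∀ j, c j < J) (hy0 : ∀ j, 0 ≤ y j)
    (hyD : ∀ j, y j ≤ D (c j)) (hD : ∀ i, 0 ≤ D i)
    (hmono : ∀ j, c j = c (j + 1) → y j ≤ y (j + 1)) :
    ∑ j ∈ Finset.range m, |y (j + 1) - y j| ^ p ≤ 2 * ∑ i ∈ Finset.range J, |D i| ^ p := by
  have hp0 : 0 ≤ p := by positivity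
  set d : ℕ → ℝ := fun i => |D i| ^ p
  have hd : ∀ i, 0 ≤ d i := fun i => by positivity
  set P : ℕ → ℝ := fun a => ∑ i ∈ Finset.range a, d i with hP
  have hPm : Monotone P := fun a b h => Finset.sum_le_sum_of_subset_of_nonneg
    (Finset.range_mono h) fun i _ _ => hd i
  have hP0 : ∀ a, 0 ≤ P a := fun a => Finset.sum_nonneg fun i _ => hd i
  have hPs : ∀ a, P (a + 1) = P a + d a := fun a => Finset.sum_range_succ _ _
  have hyd : ∀ j, y j ^ p ≤ d (c j) := fun j => by
    simp only [d, abs_of_nonneg (hD (c j))]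
    exact Real.rpow_le_rpow (hy0 j) (hyD j) hp0
  -- Inside a cell `y` increases and superadditivity of `x ^ p` lets `y ^ p` telescope. On leaving a
  -- cell, `2 * P` gains at least `2 * d (c j)`, which pays for the reset from `-y j ^ p` to `+y j ^
  -- p`.
  have key : ∀ j, |y (j + 1) - y j| ^ p
      ≤ (2 * P (c (j + 1)) + y (j + 1) ^ p) - (2 * P (c j) + y j ^ p) := by
    intro j
    rcases (hc (Nat.le_succ j)).eq_or_lt with h | h
    · have h' := hmono j h
      rw [abs_of_nonneg (sub_nonneg.2 h'), ← h]
      have := Real.add_rpow_le_rpow_add (sub_nonneg.2 h') (hy0 j) hp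
      rw [sub_add_cancel] at this
      linarith
    · have h1 := hPm (Nat.succ_le_of_lt h)
      have h2 := hPs (c j)
      have h3 : |y (j + 1) - y j| ^ p ≤ y (j + 1) ^ p + y j ^ p := by
        rcases le_total (y j) (y (j + 1)) with h' | h'
        · rw [abs_of_nonneg (sub_nonneg.2 h')]
          have := Real.rpow_le_rpow (sub_nonneg.2 h') (sub_le_self _ (hy0 j)) hp0
          have := Real.rpow_nonneg (hy0 j) p
          linarith
        · rw [abs_sub_comm, abs_of_nonneg (sub_nonneg.2 h')]
          have := Real.rpow_le_rpow (sub_nonneg.2 h') (sub_le_self _ (hy0 (j + 1))) hp0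
          have := Real.rpow_nonneg (hy0 (j + 1)) p
          linarith
      have h4 := hyd j
      simp only [Nat.succ_eq_add_one] at h1
      linarith
  refine (Finset.sum_le_sum fun j _ => key j).trans ?_
  rw [Finset.sum_range_sub (fun j => 2 * P (c j) + y j ^ p)]
  have h1 := hPm (Nat.succ_le_of_lt (hcJ m))
  have h2 := hPs (c m)
  have h3 := hyd m
  have h4 := hd (c m)
  have h5 := hP0 (c 0)
  have h6 := Real.rpow_nonneg (hy0 0) p
  simp only [Nat.succ_eq_add_one] at h1
  show _ ≤ 2 * P J
  linarith

/-! ### Quantile cells of the mean function -/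

/-- Quantile points of an increasing sequence: outside of the cells
`[a (2 j), a (2 j + 1)]`, on which `G` increases by at most `(K + 1) / J`, there are no points
`t ≤ R`. -/
theorem exists_quantile_points (G : ℕ → ℝ) (hG : Monotone G) {K : ℝ} (hK : 0 ≤ K)
    (hG0 : ∀ a, 0 ≤ G a) (hGK : ∀ a, G a ≤ K) (J : ℕ) (hJ : 0 < J) (R : ℕ) :
    ∃ (a c : ℕ → ℕ), Monotone a ∧ Monotone c ∧ (∀ t, c t < J) ∧
      (∀ t ≤ R, a (2 * c t) ≤ t ∧ t ≤ a (2 * c t + 1)) ∧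
      ∀ j, G (a (2 * j + 1)) - G (a (2 * j)) ≤ (K + 1) / J := by
  have hJ' : (0 : ℝ) < J := by exact_mod_cast hJ
  -- With `K + 1` in place of `K`, `δ` is positive and `G t / δ < J` strictly, so the cell index
  -- stays below `J`.
  set δ : ℝ := (K + 1) / J with hδ
  have hδ0 : 0 < δ := by positivity
  -- The alternative `R < a` makes every set nonempty, so the first passage `q j` is defined even
  -- for levels that `G` never reaches.
  set S : ℕ → Set ℕ := fun j => {a | j * δ ≤ G a ∨ R < a} with hS
  set q : ℕ → ℕ := fun j => sInf (S j) with hq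
  have hSne : ∀ j, (S j).Nonempty := fun j => ⟨R + 1, Or.inr (Nat.lt_succ_self R)⟩
  have hmem : ∀ j, q j ∈ S j := fun j => Nat.sInf_mem (hSne j)
  have hle : ∀ j a, a ∈ S j → q j ≤ a := fun j a h => Nat.sInf_le h
  have hup : ∀ j, S (j + 1) ⊆ S j := by
    rintro j a (h | h)
    · left
      push_cast at h
      linarith
    · exact Or.inr h
  have hqs : ∀ j, q j ≤ q (j + 1) := fun j => hle j _ (hup j (hmem (j + 1)))
  -- Cell `j` runs from `q j` to the last index before `q (j + 1)`. A large jump of `G` thus falls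
  -- between two cells; the maximum makes the cell of a skipped level a single point.
  refine ⟨fun u => if u % 2 = 0 then q (u / 2) else max (q (u / 2)) (q (u / 2 + 1) - 1),
    fun t => ⌊G t / δ⌋₊, ?_, ?_, ?_, ?_, ?_⟩
  · refine monotone_nat_of_le_succ fun u => ?_
    rcases Nat.even_or_odd' u with ⟨c, rfl | rfl⟩
    · have h1 : (2 * c + 1) / 2 = c := by omega
      have h2 : 2 * c / 2 = c := by omega
      simp [h1, h2]
    · have h1 : (2 * c + 1) / 2 = c := by omega
      have h2 : (2 * c + 1 + 1) / 2 = c + 1 := by omega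
      have h3 : (2 * c + 1) % 2 = 1 := by omega
      have h4 : (2 * c + 1 + 1) % 2 = 0 := by omega
      have := hqs c
      simp only [h1, h2, h3, h4]
      simp
      omega
  · intro s t h
    exact Nat.floor_mono (div_le_div_of_nonneg_right (hG h) hδ0.le)
  · intro t
    rw [Nat.floor_lt (div_nonneg (hG0 t) hδ0.le), div_lt_iff₀ hδ0, hδ, mul_div_cancel₀ _ hJ'.ne']
    linarith [hGK t]
  · intro t ht
    have h1 : (2 * ⌊G t / δ⌋₊ + 1) / 2 = ⌊G t / δ⌋₊ := by omega
    have h3 : (2 * ⌊G t / δ⌋₊ + 1) % 2 = 1 := by omega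
    have hlo : (⌊G t / δ⌋₊ : ℝ) * δ ≤ G t := by
      rw [← le_div_iff₀ hδ0]; exact Nat.floor_le (div_nonneg (hG0 t) hδ0.le)
    have hhi : G t < ((⌊G t / δ⌋₊ + 1 : ℕ) : ℝ) * δ := by
      rw [← div_lt_iff₀ hδ0]; push_cast; exact Nat.lt_floor_add_one _
    constructor
    · simp
      exact hle _ _ (Or.inl hlo)
    · simp only [h1, h3]
      have : t < q (⌊G t / δ⌋₊ + 1) := by
        by_contra h
        push Not at h
        rcases hmem (⌊G t / δ⌋₊ + 1) with h' | h'
        · have := hG h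
          linarith
        · omega
      simp
      omega
  · intro j
    have h1 : (2 * j + 1) / 2 = j := by omega
    have h3 : (2 * j + 1) % 2 = 1 := by omega
    simp [h1]
    rcases le_total (q (j + 1) - 1) (q j) with h | h
    · rw [max_eq_left h]; linarith
    · rw [max_eq_right h]
      rcases h.eq_or_lt with h' | h'
      · rw [h']; linarith
      have hn : q (j + 1) - 1 ∉ S (j + 1) := fun h2 => by
        have := hle _ _ h2
        omega
      simp only [hS, Set.mem_ofPred_eq, not_or, not_le, not_lt] at hn
      rcases hmem j with h2 | h2
      · have := hn.1
        push_cast at this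
        linarith
      · omega

/-! ### Concentration by bounded differences -/

/-- Exchange the summands one at a time. This makes `g` of the sum a bounded random variable, which
supplies integrability below. -/
theorem abs_sub_sum_le_of_bounded_differences {Ω F : Type*} [AddCommMonoid F]
    {V : ℕ → Ω → F} {A : Set F}
    (hA : ∀ i ω, V i ω ∈ A) {c : ℝ≥0} {g : F → ℝ}
    (hgc : ∀ x, ∀ v ∈ A, ∀ v' ∈ A, |g (x + v) - g (x + v')| ≤ c) (n : ℕ) (y : F) (ω ω' : Ω) :
    |g (y + ∑ i ∈ Finset.range n, V i ω) - g (y + ∑ i ∈ Finset.range n, V i ω')| ≤ n * c := by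
  induction n generalizing y with
  | zero => simp
  | succ n ih =>
    rw [Finset.sum_range_succ, Finset.sum_range_succ]
    have h1 := hgc (y + ∑ i ∈ Finset.range n, V i ω) _ (hA n ω) _ (hA n ω')
    have h2 := ih (y + V n ω')
    rw [add_right_comm y, add_right_comm y] at h2
    rw [add_assoc, add_assoc] at h1
    rw [add_assoc, add_assoc, add_comm (V n ω'), add_comm (V n ω')] at h2
    have := abs_sub_le (g (y + (∑ i ∈ Finset.range n, V i ω + V n ω)))
      (g (y + (∑ i ∈ Finset.range n, V i ω + V n ω')))
      (g (y + (∑ i ∈ Finset.range n, V i ω' + V n ω')))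
    push_cast
    linarith

section Concentration

variable {Ω F : Type*} [MeasurableSpace Ω] {μ : Measure Ω} [IsProbabilityMeasure μ]
  [AddCommMonoid F] [MeasurableSpace F] [MeasurableAdd₂ F]

theorem integral_comp_indepFun {E : Type*} [MeasurableSpace E] {S W : Ω → E}
    (hS : Measurable S) (hW : Measurable W) (hind : IndepFun S W μ) {φ : E × E → ℝ}
    (hφ : Measurable φ) (hint : Integrable (fun ω => φ (S ω, W ω)) μ) :
    ∫ ω, φ (S ω, W ω) ∂μ = ∫ ω, ∫ ω', φ (S ω, W ω') ∂μ ∂μ := by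
  have hlaw := (indepFun_iff_map_prod_eq_prod_map_map hS.aemeasurable hW.aemeasurable).1 hind
  have hSW : Measurable fun ω => (S ω, W ω) := hS.prodMk hW
  have : IsProbabilityMeasure (μ.map W) := Measure.isProbabilityMeasure_map hW.aemeasurable
  have : IsProbabilityMeasure (μ.map S) := Measure.isProbabilityMeasure_map hS.aemeasurable
  have h1 := integral_map hSW.aemeasurable (μ := μ) (f := φ) hφ.aestronglyMeasurable
  rw [← h1, hlaw, integral_prod, integral_map hS.aemeasurable]
  · refine integral_congr_ae (.of_forall fun ω => ?_)
    exact integral_map hW.aemeasurable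
      (hφ.comp measurable_prodMk_left).aestronglyMeasurable
  · exact (hφ.stronglyMeasurable.integral_prod_right').aestronglyMeasurable
  · rw [← hlaw]
    exact (integrable_map_measure hφ.aestronglyMeasurable hSW.aemeasurable).2 hint

theorem integrable_of_forall_abs_le {f : Ω → ℝ} (hf : Measurable f) {C : ℝ}
    (h : ∀ ω, |f ω| ≤ C) : Integrable f μ :=
  Integrable.of_bound hf.aestronglyMeasurable C (.of_forall h)

/-- A function with bounded differences of a sum of independent random elements is
sub-Gaussian. -/
theorem hasSubgaussianMGF_of_bounded_differences {V : ℕ → Ω → F} (hV : ∀ i, Measurable (V i))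
    (hind : iIndepFun V μ) {A : Set F} (hA : ∀ i ω, V i ω ∈ A) {c : ℝ≥0} {g : F → ℝ}
    (hg : Measurable g) (hgc : ∀ x, ∀ v ∈ A, ∀ v' ∈ A, |g (x + v) - g (x + v')| ≤ c) (n : ℕ) :
    HasSubgaussianMGF (fun ω => g (∑ i ∈ Finset.range n, V i ω)
      - ∫ ω', g (∑ i ∈ Finset.range n, V i ω') ∂μ) (n * c ^ 2) μ := by
  induction n generalizing g with
  | zero => simp
  | succ n ih =>
    obtain ⟨ω₀⟩ : Nonempty Ω := nonempty_of_isProbabilityMeasure μ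
    -- Averaging over the last summand preserves the bounded differences, so the induction
    -- hypothesis applies with `h` in place of `g`.
    set h : F → ℝ := fun x => ∫ ω, g (x + V n ω) ∂μ with hh
    have hgm : ∀ x, Measurable fun ω => g (x + V n ω) := fun x =>
      hg.comp ((measurable_const_add x).comp (hV n))
    have hgi : ∀ x, Integrable (fun ω => g (x + V n ω)) μ := fun x =>
      integrable_of_forall_abs_le (hgm x) (C := |g (x + V n ω₀)| + c) fun ω => by
        have h1 := hgc x _ (hA n ω) _ (hA n ω₀)
        have h2 := abs_sub_abs_le_abs_sub (g (x + V n ω)) (g (x + V n ω₀))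
        linarith
    have hhm : Measurable h := by
      have : Measurable fun z : F × Ω => g (z.1 + V n z.2) :=
        hg.comp (measurable_fst.add ((hV n).comp measurable_snd))
      exact this.stronglyMeasurable.integral_prod_right'.measurable
    have hdev : ∀ x ω, |g (x + V n ω) - h x| ≤ c := by
      intro x ω
      have e : g (x + V n ω) - h x = ∫ ω', (g (x + V n ω) - g (x + V n ω')) ∂μ := by
        rw [integral_sub (integrable_const _) (hgi x)]; simp [hh]
      rw [e]
      have := norm_integral_le_of_norm_le_const (μ := μ)
        (f := fun ω' => g (x + V n ω) - g (x + V n ω')) (C := c)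
        (.of_forall fun ω' => hgc x _ (hA n ω) _ (hA n ω'))
      simpa using this
    have hhc : ∀ x, ∀ v ∈ A, ∀ v' ∈ A, |h (x + v) - h (x + v')| ≤ c := by
      intro x v hv v' hv'
      have e : h (x + v) - h (x + v') = ∫ ω, (g (x + v + V n ω) - g (x + v' + V n ω)) ∂μ := by
        rw [integral_sub (hgi _) (hgi _)]
      rw [e]
      have := norm_integral_le_of_norm_le_const (μ := μ)
        (f := fun ω => g (x + v + V n ω) - g (x + v' + V n ω)) (C := c)
        (.of_forall fun ω => by
          rw [add_right_comm x v, add_right_comm x v']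
          exact hgc _ v hv v' hv')
      simpa using this
    set S : Ω → F := fun ω => ∑ i ∈ Finset.range n, V i ω with hS
    have hSm : Measurable S := Finset.measurable_sum _ fun i _ => hV i
    have hSV : IndepFun S (V n) μ := by
      have := hind.indepFun_sum_range_succ hV n
      rwa [show (∑ j ∈ Finset.range n, V j) = S from by
        funext ω; simp [hS, Finset.sum_apply]] at this
    have ih' := ih hhm hhc
    simp only [Finset.sum_range_succ]
    change HasSubgaussianMGF (fun ω => g (S ω + V n ω) - ∫ ω', g (S ω' + V n ω') ∂μ) _ μ
    have hsum_m : Measurable fun ω => g (S ω + V n ω) := hg.comp (hSm.add (hV n))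
    have hbdd : ∀ ω, |g (S ω + V n ω)| ≤ |g (S ω₀ + V n ω₀)| + (n + 1 : ℕ) * c := by
      intro ω
      have h1 := abs_sub_sum_le_of_bounded_differences hA hgc (n + 1) 0 ω ω₀
      simp only [Finset.sum_range_succ, zero_add] at h1
      have h2 := abs_sub_abs_le_abs_sub (g (S ω + V n ω)) (g (S ω₀ + V n ω₀))
      linarith
    have hmean : ∫ ω, g (S ω + V n ω) ∂μ = ∫ ω, h (S ω) ∂μ :=
      integral_comp_indepFun hSm (hV n) hSV (φ := fun z => g (z.1 + z.2))
        (hg.comp measurable_add) (integrable_of_forall_abs_le hsum_m hbdd)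
    rw [hmean]
    set M : ℝ := ∫ ω, h (S ω) ∂μ with hM
    have hint : ∀ s : ℝ, Integrable (fun ω => Real.exp (s * (g (S ω + V n ω) - M))) μ := by
      intro s
      refine integrable_of_forall_abs_le (by fun_prop)
        (C := Real.exp (|s| * (|g (S ω₀ + V n ω₀)| + (n + 1 : ℕ) * c + |M|))) fun ω => ?_
      rw [Real.abs_exp, Real.exp_le_exp]
      refine (le_abs_self _).trans ?_
      rw [abs_mul]
      refine mul_le_mul_of_nonneg_left ?_ (abs_nonneg _)
      exact (abs_sub _ _).trans (add_le_add (hbdd ω) le_rfl)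
    refine ⟨hint, fun s => ?_⟩
    have hinner : ∀ x, ∫ ω', Real.exp (s * (g (x + V n ω') - M)) ∂μ
        ≤ Real.exp ((c : ℝ) ^ 2 * s ^ 2 / 2) * Real.exp (s * (h x - M)) := by
      intro x
      -- Hoeffding's lemma for fixed `x`: the values lie within `c` of their mean `h x`, and half
      -- the interval length is `c`, so this step adds `c ^ 2` to the variance proxy.
      have h1 := (hasSubgaussianMGF_of_mem_Icc (μ := μ) (X := fun ω => g (x + V n ω))
        (a := h x - c) (b := h x + c) (hgm x).aemeasurable (.of_forall fun ω => by
          have := abs_le.1 (hdev x ω)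
          constructor <;> linarith)).mgf_le s
      have e : ((‖h x + c - (h x - c)‖₊ / 2 : ℝ≥0) : ℝ) = c := by
        have : h x + c - (h x - c) = 2 * (c : ℝ) := by ring
        rw [this]
        push_cast
        rw [Real.norm_of_nonneg (by positivity)]
        ring
      rw [NNReal.coe_pow, e] at h1
      have e2 : ∀ ω', Real.exp (s * (g (x + V n ω') - M))
          = Real.exp (s * (g (x + V n ω') - h x)) * Real.exp (s * (h x - M)) := fun ω' => by
        rw [← Real.exp_add]; ring_nf
      simp only [e2]
      rw [integral_mul_const]
      exact mul_le_mul_of_nonneg_right h1 (Real.exp_nonneg _)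
    have hfub := integral_comp_indepFun hSm (hV n) hSV
      (φ := fun z => Real.exp (s * (g (z.1 + z.2) - M)))
      (Real.measurable_exp.comp (((hg.comp measurable_add).sub_const M).const_mul s)) (hint s)
    have hih := ih'.mgf_le s
    rw [mgf] at hih ⊢
    rw [hfub]
    have hdom : Integrable (fun ω => Real.exp ((c : ℝ) ^ 2 * s ^ 2 / 2)
        * Real.exp (s * (h (S ω) - M))) μ := (ih'.integrable_exp_mul s).const_mul _
    refine (integral_mono_of_nonneg (.of_forall fun ω => integral_nonneg fun _ =>
      Real.exp_nonneg _) hdom (.of_forall fun ω => hinner (S ω))).trans ?_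
    rw [integral_const_mul]
    refine (mul_le_mul_of_nonneg_left hih (Real.exp_nonneg _)).trans_eq ?_
    rw [← Real.exp_add]
    congr 1
    push_cast
    ring

end Concentration

/-! ### The dyadic norm and the reduction of `p`-variation to it -/

/-- The sum over all dyadic levels of the `ℓ^p` norms of the increments at that level. -/
noncomputable def dyadicNorm (p : ℝ) (L : ℕ) (x : ℕ → ℝ) : ℝ :=
  ∑ k ∈ Finset.range (L + 1),
    lpSum p (2 ^ k) (fun i => x ((i + 1) * 2 ^ (L - k)) - x (i * 2 ^ (L - k)))

theorem measurable_dyadicNorm (p : ℝ) (L : ℕ) : Measurable (dyadicNorm p L) := by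
  unfold dyadicNorm
  refine Finset.measurable_sum _ fun k _ => (measurable_lpSum p _).comp ?_
  fun_prop

theorem abs_dyadicNorm_sub_le {p : ℝ} (hp : 1 ≤ p) (L : ℕ) (x y : ℕ → ℝ) :
    |dyadicNorm p L x - dyadicNorm p L y| ≤ dyadicNorm p L (fun i => x i - y i) := by
  unfold dyadicNorm
  rw [← Finset.sum_sub_distrib]
  refine (Finset.abs_sum_le_sum_abs _ _).trans (Finset.sum_le_sum fun k _ => ?_)
  refine (lpSum_sub_le hp _ _ _).trans_eq ?_
  congr 1; funext i; ring

/-- At each of the `L + 1` levels the `ℓ^p` norm is at most the `ℓ^1` norm, hence at most the total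
variation of `v` plus that of `w`. -/
theorem dyadicNorm_sub_le {p : ℝ} (hp : 1 ≤ p) (L : ℕ) {K : ℝ} {v w : ℕ → ℝ} (hv : Monotone v)
    (hw : Monotone w) (hv0 : ∀ a, 0 ≤ v a) (hw0 : ∀ a, 0 ≤ w a) (hvK : ∀ a, v a ≤ K)
    (hwK : ∀ a, w a ≤ K) : dyadicNorm p L (fun i => v i - w i) ≤ 2 * K * (L + 1) := by
  have key : ∀ k ∈ Finset.range (L + 1), lpSum p (2 ^ k) (fun i =>
      (v ((i + 1) * 2 ^ (L - k)) - w ((i + 1) * 2 ^ (L - k)))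
        - (v (i * 2 ^ (L - k)) - w (i * 2 ^ (L - k)))) ≤ 2 * K := by
    intro k _
    refine (lpSum_le_sum_abs hp _ _).trans ?_
    have h1 : ∀ i : ℕ, |(v ((i + 1) * 2 ^ (L - k)) - w ((i + 1) * 2 ^ (L - k)))
        - (v (i * 2 ^ (L - k)) - w (i * 2 ^ (L - k)))|
        ≤ (v ((i + 1) * 2 ^ (L - k)) + w ((i + 1) * 2 ^ (L - k)))
          - (v (i * 2 ^ (L - k)) + w (i * 2 ^ (L - k))) := by
      intro i
      have hle : i * 2 ^ (L - k) ≤ (i + 1) * 2 ^ (L - k) := Nat.mul_le_mul_right _ i.le_succ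
      have := hv hle
      have := hw hle
      rw [abs_le]; constructor <;> linarith
    refine (Finset.sum_le_sum fun i _ => h1 i).trans ?_
    rw [Finset.sum_range_sub (fun i => v (i * 2 ^ (L - k)) + w (i * 2 ^ (L - k)))]
    linarith [hvK (2 ^ k * 2 ^ (L - k)), hwK (2 ^ k * 2 ^ (L - k)), hv0 (0 * 2 ^ (L - k)),
      hw0 (0 * 2 ^ (L - k))]
  refine (Finset.sum_le_sum key).trans_eq ?_
  simp
  ring

theorem sum_even_le (d : ℕ → ℝ) (hd : ∀ i, 0 ≤ d i) (J : ℕ) :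
    ∑ i ∈ Finset.range J, d (2 * i) ≤ ∑ i ∈ Finset.range (2 * J), d i := by
  induction J with
  | zero => simp
  | succ J ih =>
    rw [Finset.sum_range_succ, show 2 * (J + 1) = 2 * J + 1 + 1 by ring, Finset.sum_range_succ,
      Finset.sum_range_succ]
    linarith [hd (2 * J + 1)]

/-- Increments over cells are the even-numbered increments of the finest level. -/
theorem lpSum_le_dyadicNorm (p : ℝ) (hp : 1 ≤ p) (l : ℕ) (x : ℕ → ℝ) :
    lpSum p (2 ^ l) (fun i => x (2 * i + 1) - x (2 * i)) ≤ dyadicNorm p (l + 1) x := by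
  have h1 : lpSum p (2 ^ l) (fun i => x (2 * i + 1) - x (2 * i))
      ≤ lpSum p (2 ^ (l + 1)) (fun i => x (i + 1) - x i) := by
    refine lpSum_mono hp ?_
    rw [pow_succ, mul_comm]
    exact sum_even_le (fun i => |x (i + 1) - x i| ^ p) (fun _ => by positivity) _
  refine h1.trans ?_
  unfold dyadicNorm
  rw [Finset.sum_range_succ]
  simp only [Nat.sub_self, pow_zero, mul_one]
  exact le_add_of_nonneg_left (Finset.sum_nonneg fun _ _ => lpSum_nonneg _ _ _)

/-- The part of the `p`-variation of an increasing function inside of cells. -/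
theorem lpSum_cells_le {p : ℝ} (hp : 1 ≤ p) (m J : ℕ) (H : ℕ → ℝ) (hH : Monotone H) (a c t : ℕ → ℕ)
    (ha : Monotone a) (hc : Monotone c) (hcJ : ∀ t, c t < J) (ht : Monotone t)
    (hact : ∀ j, a (2 * c (t j)) ≤ t j ∧ t j ≤ a (2 * c (t j) + 1)) :
    lpSum p m (fun j => (H (t (j + 1)) - H (a (2 * c (t (j + 1)))))
        - (H (t j) - H (a (2 * c (t j)))))
      ≤ 2 * lpSum p J (fun i => H (a (2 * i + 1)) - H (a (2 * i))) := by
  refine lpSum_le_two_mul hp ?_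
  have h := sum_abs_sub_rpow_le_cells hp m J (fun j => H (t j) - H (a (2 * c (t j))))
    (fun j => c (t j)) (fun i => H (a (2 * i + 1)) - H (a (2 * i))) (hc.comp ht)
    (fun j => hcJ _) (fun j => sub_nonneg.2 (hH (hact j).1))
    (fun j => sub_le_sub_right (hH (hact j).2) _)
    (fun i => sub_nonneg.2 (hH (ha (Nat.le_succ _))))
    (fun j hj => by rw [← hj]; exact sub_le_sub_right (hH (ht (Nat.le_succ j))) _)
  refine h.trans (mul_le_mul_of_nonneg_right ?_ (Finset.sum_nonneg fun _ _ => by positivity))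
  exact Real.self_le_rpow_of_one_le (by norm_num) hp

/-- Deterministic bound for the `p`-variation of the difference of two increasing functions, the
second of which has increments at most `e` on the cells. -/
theorem lpSum_increments_le {p : ℝ} (hp : 1 ≤ p) (m l : ℕ) (H A : ℕ → ℝ) (hH : Monotone H)
    (hA : Monotone A) (a c t : ℕ → ℕ) (ha : Monotone a) (hc : Monotone c)
    (hcJ : ∀ t, c t < 2 ^ l) (ht : Monotone t)
    (hact : ∀ j, a (2 * c (t j)) ≤ t j ∧ t j ≤ a (2 * c (t j) + 1)) {e : ℝ}
    (he : ∀ i, A (a (2 * i + 1)) - A (a (2 * i)) ≤ e) :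
    lpSum p m (fun j => (H (t (j + 1)) - A (t (j + 1))) - (H (t j) - A (t j)))
      ≤ 4 * dyadicNorm p (l + 1) (fun u => H (a u) - A (a u))
        + 4 * (((2 ^ l : ℕ) : ℝ) ^ (1 / p) * e) := by
  set X : ℕ → ℝ := fun u => H (a u) - A (a u) with hX
  have h1 := lpSum_increments_le_dyadic hp m (l + 1) X (fun j => 2 * c (t j))
    (fun i j h => Nat.mul_le_mul_left _ (hc (ht h)))
    (fun j => by have := hcJ (t j); rw [pow_succ]; omega)
  change _ ≤ 2 * dyadicNorm p (l + 1) X at h1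
  have h2 := lpSum_cells_le hp m _ H hH a c t ha hc hcJ ht hact
  have h3 := lpSum_cells_le hp m _ A hA a c t ha hc hcJ ht hact
  have h4 : lpSum p (2 ^ l) (fun i => A (a (2 * i + 1)) - A (a (2 * i)))
      ≤ ((2 ^ l : ℕ) : ℝ) ^ (1 / p) * e :=
    lpSum_le_of_abs_le hp _ fun i => by
      rw [abs_of_nonneg (sub_nonneg.2 (hA (ha (Nat.le_succ _))))]
      exact he i
  -- No direct bound is available for the increments of `H` over cells; they are those of `A` plus
  -- those of `X`, and the latter are absorbed by the dyadic norm.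
  have h5 := lpSum_add_le hp (2 ^ l) (fun i => X (2 * i + 1) - X (2 * i))
    (fun i => A (a (2 * i + 1)) - A (a (2 * i)))
  have h6 : (fun i => X (2 * i + 1) - X (2 * i) + (A (a (2 * i + 1)) - A (a (2 * i))))
      = fun i => H (a (2 * i + 1)) - H (a (2 * i)) := by
    funext i; simp only [hX]; ring
  rw [h6] at h5
  have h7 := lpSum_le_dyadicNorm p hp l X
  set y1 : ℕ → ℝ := fun j => (H (t (j + 1)) - H (a (2 * c (t (j + 1)))))
        - (H (t j) - H (a (2 * c (t j)))) with hy1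
  set y2 : ℕ → ℝ := fun j => (A (t (j + 1)) - A (a (2 * c (t (j + 1)))))
        - (A (t j) - A (a (2 * c (t j)))) with hy2
  have h8 := lpSum_add_le hp m (fun j => X (2 * c (t (j + 1))) - X (2 * c (t j)))
    (fun j => y1 j - y2 j)
  have h9 := abs_le.1 (lpSum_sub_le hp m (fun j => y1 j - y2 j) (fun j => - y2 j))
  have h10 : lpSum p m (fun j => - y2 j) = lpSum p m y2 := by simp [lpSum]
  have h11 := lpSum_add_le hp m y1 (fun j => - y2 j)
  simp only [← sub_eq_add_neg] at h11
  have h12 : (fun j => X (2 * c (t (j + 1))) - X (2 * c (t j)) + (y1 j - y2 j))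
      = fun j => (H (t (j + 1)) - A (t (j + 1))) - (H (t j) - A (t j)) := by
    funext j; simp only [hX, hy1, hy2]; ring
  rw [h12] at h8
  linarith

/-- The triangle inequality removes `x` and the centring, leaving the dyadic norm of a difference of
two bounded monotone sequences. -/
theorem dyadicNorm_bounded_differences {K : ℝ} (hK : 0 ≤ K) (G : ℕ → ℝ) {p : ℝ} (hp : 1 ≤ p)
    (L n : ℕ) (b : ℕ → ℕ) (hb : Monotone b) (x : ℕ → ℝ) :
    ∀ v ∈ {v : ℕ → ℝ | Monotone v ∧ ∀ a, 0 ≤ v a ∧ v a ≤ K},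
    ∀ v' ∈ {v : ℕ → ℝ | Monotone v ∧ ∀ a, 0 ≤ v a ∧ v a ≤ K},
    |dyadicNorm p L (fun u => (x + v) (b u) - n * G (b u))
      - dyadicNorm p L (fun u => (x + v') (b u) - n * G (b u))|
      ≤ (2 * K * (L + 1)).toNNReal := by
  rintro v ⟨hv, hv'⟩ w ⟨hw, hw'⟩
  rw [Real.coe_toNNReal _ (by positivity)]
  refine (abs_dyadicNorm_sub_le hp L _ _).trans ?_
  refine le_trans (le_of_eq ?_) (dyadicNorm_sub_le hp L (hv.comp hb) (hw.comp hb)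
    (fun a => (hv' _).1) (fun a => (hw' _).1) (fun a => (hv' _).2) (fun a => (hw' _).2))
  congr 1; funext i; simp only [Pi.add_apply, Function.comp_apply]; ring

/-! ### Second moments of centred sums of monotone sequences -/

section Sample

variable {Ω : Type*} [MeasurableSpace Ω]

/-- Independent increasing random sequences with values in `[0, K]` and common mean `G`. -/
structure IsMonotoneSample (μ : Measure Ω) (K : ℝ) (G : ℕ → ℝ) (ξ : ℕ → Ω → ℕ → ℝ) : Prop where
  measurable : ∀ i, Measurable (ξ i)
  indep : iIndepFun ξ μ
  mono : ∀ i ω, Monotone (ξ i ω)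
  nonneg : ∀ i ω a, 0 ≤ ξ i ω a
  le : ∀ i ω a, ξ i ω a ≤ K
  mean : ∀ i a, ∫ ω, ξ i ω a ∂μ = G a

/-- The centred sum of the first `n` sequences. -/
def centredSum (G : ℕ → ℝ) (ξ : ℕ → Ω → ℕ → ℝ) (n : ℕ) (ω : Ω) (a : ℕ) : ℝ :=
  ∑ i ∈ Finset.range n, ξ i ω a - n * G a

variable {μ : Measure Ω} {K : ℝ} {G : ℕ → ℝ} {ξ : ℕ → Ω → ℕ → ℝ}

namespace IsMonotoneSample

theorem measurable_apply (h : IsMonotoneSample μ K G ξ) (i a : ℕ) :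
    Measurable fun ω => ξ i ω a := (measurable_pi_apply a).comp (h.measurable i)

theorem mean_nonneg (h : IsMonotoneSample μ K G ξ) (a : ℕ) : 0 ≤ G a := by
  rw [← h.mean 0 a]; exact integral_nonneg fun ω => h.nonneg 0 ω a

theorem measurable_centredSum (h : IsMonotoneSample μ K G ξ) (n a : ℕ) :
    Measurable fun ω => centredSum G ξ n ω a :=
  (Finset.measurable_sum _ fun i _ => h.measurable_apply i a).sub_const _

variable [IsProbabilityMeasure μ]

theorem integrable (h : IsMonotoneSample μ K G ξ) (i a : ℕ) : Integrable (fun ω => ξ i ω a) μ :=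
  integrable_of_forall_abs_le (h.measurable_apply i a) fun ω =>
    (abs_of_nonneg (h.nonneg i ω a)).trans_le (h.le i ω a)

theorem mean_mono (h : IsMonotoneSample μ K G ξ) : Monotone G := fun a b hab => by
  rw [← h.mean 0 a, ← h.mean 0 b]
  exact integral_mono (h.integrable 0 a) (h.integrable 0 b) fun ω => h.mono 0 ω hab

theorem mean_le (h : IsMonotoneSample μ K G ξ) (a : ℕ) : G a ≤ K := by
  rw [← h.mean 0 a]
  refine (integral_mono (h.integrable 0 a) (integrable_const K) fun ω => h.le 0 ω a).trans_eq ?_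
  simp

/-- Variances of independent increments add, and an increment `Z` with values in `[0, K]` has `E Z²
≤ K E Z`. The bound is linear in `G b - G a`, so it telescopes over a partition. -/
theorem integral_centredSum_sub_sq_le (h : IsMonotoneSample μ K G ξ) (n : ℕ) {a b : ℕ}
    (hab : a ≤ b) : ∫ ω, (centredSum G ξ n ω b - centredSum G ξ n ω a) ^ 2 ∂μ
      ≤ n * (K * (G b - G a)) := by
  set Z : ℕ → Ω → ℝ := fun i ω => ξ i ω b - ξ i ω a with hZ
  have hZm : ∀ i, Measurable (Z i) := fun i => (h.measurable_apply i b).sub (h.measurable_apply i a)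
  have hZ0 : ∀ i ω, 0 ≤ Z i ω := fun i ω => sub_nonneg.2 (h.mono i ω hab)
  have hZK : ∀ i ω, Z i ω ≤ K := fun i ω => by
    linarith [h.le i ω b, h.nonneg i ω a]
  have hZL : ∀ i, MemLp (Z i) 2 μ := fun i =>
    MemLp.of_bound (hZm i).aestronglyMeasurable K (.of_forall fun ω => by
      rw [Real.norm_of_nonneg (hZ0 i ω)]; exact hZK i ω)
  have hZmean : ∀ i, ∫ ω, Z i ω ∂μ = G b - G a := fun i => by
    rw [integral_sub (h.integrable i b) (h.integrable i a), h.mean, h.mean]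
  have hZi : ∀ i, Integrable (Z i) μ := fun i => (h.integrable i b).sub (h.integrable i a)
  have hind : iIndepFun Z μ := by
    have := h.indep.comp (fun _ (x : ℕ → ℝ) => x b - x a) (fun _ => by fun_prop)
    exact this
  have hsum : Var[∑ i ∈ Finset.range n, Z i; μ] = ∑ i ∈ Finset.range n, Var[Z i; μ] :=
    IndepFun.variance_sum (fun i _ => hZL i) fun i _ j _ hij => hind.indepFun hij
  have hE : ∫ ω, (∑ i ∈ Finset.range n, Z i) ω ∂μ = n * (G b - G a) := by
    simp only [Finset.sum_apply]
    rw [integral_finsetSum _ fun i _ => hZi i]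
    simp [hZmean, mul_sub]
  rw [variance_eq_integral (Finset.aemeasurable_sum _ fun i _ => (hZm i).aemeasurable), hE] at hsum
  have hL : ∀ ω, (centredSum G ξ n ω b - centredSum G ξ n ω a) ^ 2
      = ((∑ i ∈ Finset.range n, Z i) ω - n * (G b - G a)) ^ 2 := fun ω => by
    simp only [centredSum, Finset.sum_apply, hZ, Finset.sum_sub_distrib]; ring
  simp only [hL]
  rw [hsum]
  have hvar : ∀ i, Var[Z i; μ] ≤ K * (G b - G a) := fun i => by
    refine (variance_le_expectation_sq (hZm i).aestronglyMeasurable).trans ?_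
    rw [← hZmean i, ← integral_const_mul]
    refine integral_mono_of_nonneg (.of_forall fun ω => by
      simp only [Pi.zero_apply, Pi.pow_apply]; positivity)
      ((hZi i).const_mul K) (.of_forall fun ω => ?_)
    simp only [Pi.pow_apply]
    nlinarith [hZ0 i ω, hZK i ω]
  refine (Finset.sum_le_sum fun i _ => hvar i).trans_eq ?_
  simp

theorem integrable_centredSum_sub_sq (h : IsMonotoneSample μ K G ξ) (n a b : ℕ) :
    Integrable (fun ω => (centredSum G ξ n ω b - centredSum G ξ n ω a) ^ 2) μ := by
  have hm : ∀ a, MemLp (fun ω => centredSum G ξ n ω a) 2 μ := fun a => by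
    refine MemLp.sub (memLp_finsetSum _ fun i _ => ?_) (memLp_const _)
    exact MemLp.of_bound (h.measurable_apply i a).aestronglyMeasurable K (.of_forall fun ω => by
      rw [Real.norm_of_nonneg (h.nonneg i ω a)]; exact h.le i ω a)
  exact ((hm b).sub (hm a)).integrable_sq

theorem integral_sqrt_sum_sq_le (h : IsMonotoneSample μ K G ξ) (hK : 0 < K) {n : ℕ} (hn : 0 < n)
    (b : ℕ → ℕ) (hb : Monotone b) (m : ℕ) :
    Integrable (fun ω => √(∑ i ∈ Finset.range m,
      (centredSum G ξ n ω (b (i + 1)) - centredSum G ξ n ω (b i)) ^ 2)) μ ∧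
    ∫ ω, √(∑ i ∈ Finset.range m,
      (centredSum G ξ n ω (b (i + 1)) - centredSum G ξ n ω (b i)) ^ 2) ∂μ ≤ √n * K := by
  set Q : Ω → ℝ := fun ω => ∑ i ∈ Finset.range m,
      (centredSum G ξ n ω (b (i + 1)) - centredSum G ξ n ω (b i)) ^ 2 with hQ
  have hn' : (0 : ℝ) < n := by exact_mod_cast hn
  have hQ0 : ∀ ω, 0 ≤ Q ω := fun ω => Finset.sum_nonneg fun _ _ => by positivity
  have hQi : Integrable Q μ := integrable_finsetSum _ fun i _ =>
    h.integrable_centredSum_sub_sq n _ _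
  have hQm : Measurable Q := Finset.measurable_sum _ fun i _ =>
    ((h.measurable_centredSum n _).sub (h.measurable_centredSum n _)).pow_const 2
  have hQE : ∫ ω, Q ω ∂μ ≤ n * K ^ 2 := by
    rw [integral_finsetSum _ fun i _ => h.integrable_centredSum_sub_sq n _ _]
    refine (Finset.sum_le_sum fun i _ =>
      h.integral_centredSum_sub_sq_le n (hb (Nat.le_succ i))).trans ?_
    rw [← Finset.mul_sum, ← Finset.mul_sum, Finset.sum_range_sub (fun i => G (b i))]
    have : G (b m) - G (b 0) ≤ K := by linarith [h.mean_le (b m), h.mean_nonneg (b 0)]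
    have := mul_le_mul_of_nonneg_left (mul_le_mul_of_nonneg_left this hK.le) hn'.le
    rwa [← pow_two] at this
  set s : ℝ := √n * K with hs
  have hs0 : 0 < s := by positivity
  have hs2 : s ^ 2 = n * K ^ 2 := by rw [hs, mul_pow, Real.sq_sqrt hn'.le]
  -- AM-GM with `s` chosen so that `s ^ 2` is the bound for the mean of `Q`; it replaces Jensen's
  -- inequality and also gives integrability of the root.
  have hamgm : ∀ ω, √(Q ω) ≤ (Q ω / s + s) / 2 := fun ω => by
    have h1 := Real.sq_sqrt (hQ0 ω)
    rw [le_div_iff₀ (by norm_num), div_add' _ _ _ hs0.ne', le_div_iff₀ hs0]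
    nlinarith [sq_nonneg (√(Q ω) - s)]
  have hRi : Integrable (fun ω => (Q ω / s + s) / 2) μ :=
    ((hQi.div_const s).add (integrable_const s)).div_const 2
  refine ⟨hRi.mono' hQm.sqrt.aestronglyMeasurable (.of_forall fun ω => ?_), ?_⟩
  · rw [Real.norm_of_nonneg (Real.sqrt_nonneg _)]; exact hamgm ω
  · refine (integral_mono_of_nonneg (.of_forall fun ω => Real.sqrt_nonneg _) hRi
      (.of_forall hamgm)).trans ?_
    rw [integral_div, integral_add (hQi.div_const s) (integrable_const s), integral_div]
    simp only [integral_const, probReal_univ, one_smul]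
    have : (∫ ω, Q ω ∂μ) / s ≤ s := by
      rw [div_le_iff₀ hs0, ← pow_two, hs2]; exact hQE
    linarith

end IsMonotoneSample

end Sample

/-! ### Mean and tail of the dyadic norm -/

/-- The constant in the bound for the mean of the dyadic norm. -/
noncomputable def meanConst (p K : ℝ) : ℝ :=
  K * ((2 : ℝ) ^ (1 / p - 1 / 2)) ^ 2 / ((2 : ℝ) ^ (1 / p - 1 / 2) - 1)

/-- The probability bound for the exceptional event at sample size `n`. -/
noncomputable def tailBound (p K : ℝ) (n : ℕ) : ℝ :=
  Real.exp (-((n : ℝ) ^ (1 / p)) ^ 2 / (2 * (n * (2 * K * (Nat.log 2 n + 1 + 1)) ^ 2)))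

theorem exponent_pos {p : ℝ} (hp : 1 ≤ p) (hp2 : p < 2) : 0 < 1 / p - 1 / 2 := by
  have : 1 / 2 < 1 / p := one_div_lt_one_div_of_lt (by positivity) hp2
  linarith

/-- With `θ = 1/p - 1/2 > 0` the exponent is `-n^(2θ) / (2c²)` with `c = O(log n)`. Since eventually
`2c² ≤ n^θ`, the terms are at most `exp(-n^θ) = o(n^(-2))`. -/
theorem summable_tailBound {p K : ℝ} (hp : 1 ≤ p) (hp2 : p < 2) (hK : 0 < K) :
    Summable (tailBound p K) := by
  set θ : ℝ := 1 / p - 1 / 2 with hθ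
  have hθ0 : 0 < θ := exponent_pos hp hp2
  have hO : (fun x : ℝ => Real.exp (-(1 : ℝ) * x)) =o[atTop] fun x : ℝ => x ^ (-(2 / θ)) :=
    isLittleO_exp_neg_mul_rpow_atTop one_pos _
  have htend : Tendsto (fun n : ℕ => (n : ℝ) ^ θ) atTop atTop :=
    (tendsto_rpow_atTop hθ0).comp tendsto_natCast_atTop_atTop
  have h1 := (hO.comp_tendsto htend).isBigO
  refine summable_of_isBigO_nat (g := fun n : ℕ => (n : ℝ) ^ (-2 : ℝ))
    (Real.summable_nat_rpow.2 (by norm_num)) ?_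
  have h2 : ((fun x : ℝ => x ^ (-(2 / θ))) ∘ fun n : ℕ => (n : ℝ) ^ θ)
      = fun n : ℕ => (n : ℝ) ^ (-2 : ℝ) := by
    funext n
    simp only [Function.comp_apply]
    rw [← Real.rpow_mul (Nat.cast_nonneg n)]
    congr 1; field_simp
  rw [h2] at h1
  refine IsBigO.trans (IsBigO.of_bound 1 ?_) h1
  have hlog : (fun n : ℕ => 2 * K * (2 * Real.log n + 2)) =o[atTop]
      fun n : ℕ => (n : ℝ) ^ (θ / 2) := by
    have h3 : (fun n : ℕ => Real.log n) =o[atTop] fun n : ℕ => (n : ℝ) ^ (θ / 2) :=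
      (isLittleO_log_rpow_atTop (by positivity)).comp_tendsto tendsto_natCast_atTop_atTop
    have h4 : (fun _ : ℕ => (2 : ℝ)) =o[atTop] fun n : ℕ => (n : ℝ) ^ (θ / 2) := by
      refine isLittleO_const_left.2 (Or.inr ?_)
      exact tendsto_norm_atTop_atTop.comp
        ((tendsto_rpow_atTop (by positivity)).comp tendsto_natCast_atTop_atTop)
    exact ((h3.const_mul_left 2).add h4).const_mul_left (2 * K)
  filter_upwards [hlog.bound (by norm_num : (0 : ℝ) < 1 / 2), eventually_ge_atTop 1] with n hn hn1
  have hn0 : (0 : ℝ) < n := by exact_mod_cast hn1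
  have hlog2 : (Nat.log 2 n : ℝ) ≤ 2 * Real.log n := by
    have h5 : (2 : ℝ) ^ (Nat.log 2 n) ≤ n := by
      exact_mod_cast Nat.pow_log_le_self 2 (by omega)
    have h6 := Real.log_le_log (by positivity) h5
    rw [Real.log_pow] at h6
    have h7 := Real.log_two_gt_d9
    have : (0 : ℝ) ≤ Nat.log 2 n := Nat.cast_nonneg _
    nlinarith
  have hlogn : 0 ≤ Real.log n := Real.log_nonneg (by exact_mod_cast hn1)
  rw [Real.norm_of_nonneg (by positivity), Real.norm_of_nonneg (by positivity)] at hn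
  set c : ℝ := 2 * K * (Nat.log 2 n + 1 + 1) with hc
  have hc0 : 0 < c := by positivity
  have hcle : c ≤ 1 / 2 * (n : ℝ) ^ (θ / 2) := by
    refine le_trans ?_ hn
    exact mul_le_mul_of_nonneg_left (by linarith) (by positivity)
  have hc2 : 2 * c ^ 2 ≤ (n : ℝ) ^ θ := by
    have h8 : ((n : ℝ) ^ (θ / 2)) ^ 2 = (n : ℝ) ^ θ := by
      rw [← Real.rpow_natCast, ← Real.rpow_mul hn0.le]; norm_num
    have : 0 < (n : ℝ) ^ (θ / 2) := by positivity
    nlinarith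
  rw [tailBound, one_mul, Real.norm_of_nonneg (Real.exp_nonneg _), Function.comp_apply,
    Real.norm_of_nonneg (Real.exp_nonneg _), Real.exp_le_exp, neg_div, neg_mul, one_mul,
    neg_le_neg_iff, le_div_iff₀ (by positivity)]
  have h9 : ((n : ℝ) ^ (1 / p)) ^ 2 = n * ((n : ℝ) ^ θ * (n : ℝ) ^ θ) := by
    rw [← Real.rpow_natCast, ← Real.rpow_mul hn0.le, ← Real.rpow_add hn0]
    nth_rewrite 2 [← Real.rpow_one (n : ℝ)]
    rw [← Real.rpow_add hn0]
    congr 1; rw [hθ]; push_cast; ring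
  rw [h9]
  have : 0 < (n : ℝ) ^ θ := by positivity
  calc (n : ℝ) ^ θ * (2 * (n * c ^ 2)) = n * ((n : ℝ) ^ θ * (2 * c ^ 2)) := by ring
    _ ≤ _ := by gcongr

namespace IsMonotoneSample

variable {Ω : Type*} [MeasurableSpace Ω] {μ : Measure Ω} [IsProbabilityMeasure μ] {K : ℝ}
  {G : ℕ → ℝ} {ξ : ℕ → Ω → ℕ → ℝ}

/-- Level `k` contributes at most `ρ^k √n K` with `ρ = 2^θ > 1`. The geometric sum is controlled by
its last term, where `ρ^(log₂ n) ≤ n^θ` and `n^θ √n = n^(1/p)`. -/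
theorem integral_dyadicNorm_le (h : IsMonotoneSample μ K G ξ) (hK : 0 < K) {p : ℝ} (hp : 1 ≤ p)
    (hp2 : p < 2) {n : ℕ} (hn : 0 < n) (b : ℕ → ℕ) (hb : Monotone b) :
    ∫ ω, dyadicNorm p (Nat.log 2 n + 1) (fun u => centredSum G ξ n ω (b u)) ∂μ
      ≤ meanConst p K * (n : ℝ) ^ (1 / p) := by
  set θ : ℝ := 1 / p - 1 / 2 with hθ
  have hθ0 : 0 < θ := exponent_pos hp hp2
  set L := Nat.log 2 n + 1 with hL
  set ρ : ℝ := 2 ^ θ with hρ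
  have hρ1 : 1 < ρ := Real.one_lt_rpow (by norm_num) hθ0
  have hn' : (0 : ℝ) < n := by exact_mod_cast hn
  have hbk : ∀ k, Monotone fun i => b (i * 2 ^ (L - k)) := fun k i j hij =>
    hb (Nat.mul_le_mul_right _ hij)
  have hpow : ∀ k : ℕ, ((2 ^ k : ℕ) : ℝ) ^ θ = ρ ^ k := fun k => by
    push_cast
    rw [hρ, ← Real.rpow_natCast, ← Real.rpow_mul (by norm_num), ← Real.rpow_natCast (2 ^ θ),
      ← Real.rpow_mul (by norm_num), mul_comm]
  have h1 : ∫ ω, dyadicNorm p L (fun u => centredSum G ξ n ω (b u)) ∂μ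
      ≤ ∑ k ∈ Finset.range (L + 1), ρ ^ k * (√n * K) := by
    refine (integral_mono_of_nonneg (.of_forall fun ω => Finset.sum_nonneg fun _ _ =>
      lpSum_nonneg _ _ _) (integrable_finsetSum _ fun k _ =>
      ((h.integral_sqrt_sum_sq_le hK hn _ (hbk k) (2 ^ k)).1.const_mul (ρ ^ k)))
      (.of_forall fun ω => Finset.sum_le_sum fun k _ => ?_)).trans ?_
    · rw [← hpow k]
      exact lpSum_le_sqrt hp hp2.le _ _
    · rw [integral_finsetSum _ fun k _ =>
        ((h.integral_sqrt_sum_sq_le hK hn _ (hbk k) (2 ^ k)).1.const_mul (ρ ^ k))]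
      refine Finset.sum_le_sum fun k _ => ?_
      rw [integral_const_mul]
      exact mul_le_mul_of_nonneg_left (h.integral_sqrt_sum_sq_le hK hn _ (hbk k) (2 ^ k)).2
        (by positivity)
  refine h1.trans ?_
  rw [← Finset.sum_mul, geom_sum_eq hρ1.ne']
  have h2 : ρ ^ (L + 1) ≤ ρ ^ 2 * (n : ℝ) ^ θ := by
    have h3 : ((2 ^ Nat.log 2 n : ℕ) : ℝ) ≤ n := by
      exact_mod_cast Nat.pow_log_le_self 2 (by omega)
    have h4 := Real.rpow_le_rpow (by positivity) h3 hθ0.le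
    rw [hpow] at h4
    rw [hL, show Nat.log 2 n + 1 + 1 = 2 + Nat.log 2 n by ring, pow_add]
    exact mul_le_mul_of_nonneg_left h4 (by positivity)
  have h5 : (n : ℝ) ^ (1 / p) = (n : ℝ) ^ θ * √n := by
    rw [Real.sqrt_eq_rpow, ← Real.rpow_add hn', hθ]; congr 1; ring
  have hρ' : 0 < ρ - 1 := by linarith
  rw [meanConst, h5]
  calc (ρ ^ (L + 1) - 1) / (ρ - 1) * (√n * K)
      ≤ (ρ ^ 2 * (n : ℝ) ^ θ) / (ρ - 1) * (√n * K) := by gcongr; linarith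
    _ = _ := by ring

/-- Concentration of the dyadic norm of the centred sum. -/
theorem measure_dyadicNorm_ge_le (h : IsMonotoneSample μ K G ξ) (hK : 0 < K) {p : ℝ} (hp : 1 ≤ p)
    (hp2 : p < 2) {n : ℕ} (hn : 0 < n) (b : ℕ → ℕ) (hb : Monotone b) :
    μ {ω | (meanConst p K + 1) * (n : ℝ) ^ (1 / p)
        ≤ dyadicNorm p (Nat.log 2 n + 1) (fun u => centredSum G ξ n ω (b u))}
      ≤ ENNReal.ofReal (tailBound p K n) := by
  set L := Nat.log 2 n + 1 with hL
  set A : Set (ℕ → ℝ) := {v | Monotone v ∧ ∀ a, 0 ≤ v a ∧ v a ≤ K}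
  set g : (ℕ → ℝ) → ℝ := fun x => dyadicNorm p L (fun u => x (b u) - n * G (b u)) with hg
  have hgm : Measurable g := (measurable_dyadicNorm p L).comp (by fun_prop)
  have hA : ∀ i ω, ξ i ω ∈ A := fun i ω => ⟨h.mono i ω, fun a => ⟨h.nonneg i ω a, h.le i ω a⟩⟩
  have hsub := hasSubgaussianMGF_of_bounded_differences h.measurable h.indep hA hgm
    (dyadicNorm_bounded_differences hK.le G hp L n b hb) n
  have e : ∀ ω, g (∑ i ∈ Finset.range n, ξ i ω)
      = dyadicNorm p L (fun u => centredSum G ξ n ω (b u)) := fun ω => by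
    simp only [hg, centredSum, Finset.sum_apply]
  simp only [e] at hsub
  have htail := hsub.measure_ge_le (ε := (n : ℝ) ^ (1 / p)) (by positivity)
  have hE := h.integral_dyadicNorm_le hK hp hp2 hn b hb
  rw [← ofReal_measureReal]
  refine ENNReal.ofReal_le_ofReal ((measureReal_mono fun ω hω => ?_).trans (htail.trans_eq ?_))
  · have hω' : (meanConst p K + 1) * (n : ℝ) ^ (1 / p)
        ≤ dyadicNorm p L (fun u => centredSum G ξ n ω (b u)) := hω
    change (n : ℝ) ^ (1 / p) ≤ _ - _
    rw [add_mul, one_mul] at hω'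
    linarith
  · rw [tailBound, NNReal.coe_mul, NNReal.coe_pow, Real.coe_toNNReal _ (by positivity), hL]
    push_cast
    rfl

/-- Uniform tail bound for the `p`-variation of the centred sum on `{0, …, R}`. -/
theorem measure_increments_gt_le (h : IsMonotoneSample μ K G ξ) (hK : 0 < K) {p : ℝ} (hp : 1 ≤ p)
    (hp2 : p < 2) {n : ℕ} (hn : 0 < n) (R : ℕ) :
    μ {ω | ∃ (m : ℕ) (t : ℕ → ℕ), Monotone t ∧ (∀ j, t j ≤ R) ∧
        (4 * (meanConst p K + 1) + 8 * (K + 1)) * (n : ℝ) ^ (1 / p)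
          < lpSum p m (fun j => centredSum G ξ n ω (t (j + 1)) - centredSum G ξ n ω (t j))}
      ≤ ENNReal.ofReal (tailBound p K n) := by
  obtain ⟨a, c, ha, hc, hcJ, hact, hlight⟩ := exists_quantile_points G h.mean_mono hK.le
    h.mean_nonneg h.mean_le (2 ^ Nat.log 2 n) (by positivity) R
  refine le_trans (measure_mono ?_) (h.measure_dyadicNorm_ge_le hK hp hp2 hn a ha)
  rintro ω ⟨m, t, ht, htR, hlt⟩
  have hn' : (0 : ℝ) < n := by exact_mod_cast hn
  have hJn : ((2 ^ Nat.log 2 n : ℕ) : ℝ) ≤ n := by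
    exact_mod_cast Nat.pow_log_le_self 2 (by omega)
  -- The number `J` of cells lies between `n / 2` and `n`: the lower bound makes `n * G` grow by at
  -- most `2 * (K + 1)` on a cell, the upper one turns `J ^ (1 / p)` into `n ^ (1 / p)`.
  have hnJ : (n : ℝ) ≤ 2 * ((2 ^ Nat.log 2 n : ℕ) : ℝ) := by
    have := Nat.lt_pow_succ_log_self one_lt_two n
    rw [pow_succ] at this
    exact_mod_cast (by omega : n ≤ 2 * 2 ^ Nat.log 2 n)
  set J : ℝ := ((2 ^ Nat.log 2 n : ℕ) : ℝ) with hJ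
  have hJ0 : 0 < J := by positivity
  have hdet := lpSum_increments_le hp m (Nat.log 2 n) (fun u => ∑ i ∈ Finset.range n, ξ i ω u)
    (fun u => n * G u) (fun u v huv => Finset.sum_le_sum fun i _ => h.mono i ω huv)
    (fun u v huv => mul_le_mul_of_nonneg_left (h.mean_mono huv) hn'.le) a c t ha hc hcJ ht
    (fun j => hact _ (htR j)) (e := 2 * (K + 1)) (fun i => by
      rw [← mul_sub]
      refine (mul_le_mul_of_nonneg_left (hlight i) hn'.le).trans ?_
      rw [mul_div_assoc', div_le_iff₀ hJ0]
      nlinarith)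
  rw [← hJ] at hdet
  have h1 : J ^ (1 / p) ≤ (n : ℝ) ^ (1 / p) := Real.rpow_le_rpow hJ0.le hJn (by positivity)
  have h2 := mul_le_mul_of_nonneg_right h1 (by positivity : 0 ≤ 2 * (K + 1))
  have h3 := hlt.trans_le hdet
  change (meanConst p K + 1) * (n : ℝ) ^ (1 / p)
    ≤ dyadicNorm p (Nat.log 2 n + 1) (fun u => ∑ i ∈ Finset.range n, ξ i ω (a u) - n * G (a u))
  linarith

end IsMonotoneSample

/-! ### From finite grids to `[0, ∞)` -/

/-- As `f 0 = 0`, the partition `0 ≤ s` already controls `|f s|`, so the supremum norm costs only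
the factor 2. -/
theorem pVarNorm_le {p : ℝ} (hp : 1 ≤ p) {f : ℝ≥0 → ℝ} (hf0 : f 0 = 0) {c : ℝ} (hc : 0 ≤ c)
    (h : ∀ (m : ℕ) (t : ℕ → ℝ≥0), Monotone t →
      lpSum p m (fun j => f (t (j + 1)) - f (t j)) ≤ c) :
    pVarNorm p f ≤ ENNReal.ofReal (2 * c) := by
  have hp0 : 0 < p := by positivity
  rw [two_mul, ENNReal.ofReal_add hc hc]
  refine add_le_add ?_ ?_
  · have h1 : pVariation p f ≤ ENNReal.ofReal (c ^ p) := by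
      refine iSup_le fun m => iSup_le fun t => ?_
      rw [← ENNReal.ofReal_sum_of_nonneg fun _ _ => by positivity]
      refine ENNReal.ofReal_le_ofReal ?_
      have h2 := Real.rpow_le_rpow (lpSum_nonneg _ _ _) (h m t.1 t.2) hp0.le
      rwa [lpSum, ← Real.rpow_mul (Finset.sum_nonneg fun _ _ => by positivity),
        one_div_mul_cancel hp0.ne', Real.rpow_one] at h2
    refine (ENNReal.rpow_le_rpow h1 (by positivity)).trans_eq ?_
    rw [ENNReal.ofReal_rpow_of_nonneg (by positivity) (by positivity), ← Real.rpow_mul hc,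
      mul_one_div_cancel hp0.ne', Real.rpow_one]
  · refine iSup_le fun s => ENNReal.ofReal_le_ofReal ?_
    have h1 := h 1 (fun j => if j = 0 then 0 else s) (monotone_nat_of_le_succ fun j => by
      rcases j with _ | j <;> simp)
    simpa [lpSum, hf0, ← Real.rpow_mul, mul_inv_cancel₀ hp0.ne'] using h1

/-- The grid point of mesh `1 / (k + 1)` to the right of `x`, cut off at `k + 1`. -/
noncomputable def gridIndex (k : ℕ) (x : ℝ≥0) : ℕ := min (⌊(k + 1 : ℝ≥0) * x⌋₊ + 1) ((k + 1) ^ 2)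

theorem gridIndex_mono (k : ℕ) : Monotone (gridIndex k) := fun x y hxy => by
  unfold gridIndex
  have := Nat.floor_mono (mul_le_mul_right hxy (k + 1 : ℝ≥0))
  omega

theorem tendsto_gridIndex (x : ℝ≥0) :
    Tendsto (fun k : ℕ => (gridIndex k x : ℝ≥0) / (k + 1)) atTop (𝓝[≥] x) := by
  have hev : ∀ᶠ k : ℕ in atTop, (gridIndex k x : ℝ≥0) = (⌊(k + 1 : ℝ≥0) * x⌋₊ : ℝ≥0) + 1 := by
    filter_upwards [eventually_ge_atTop (⌈x⌉₊)] with k hk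
    have h1 : x ≤ k := (Nat.le_ceil x).trans (by exact_mod_cast hk)
    have h2 : ⌊(k + 1 : ℝ≥0) * x⌋₊ ≤ (k + 1) * k := by
      refine Nat.floor_le_of_le ?_
      push_cast
      exact mul_le_mul_right h1 _
    have h3 : ⌊(k + 1 : ℝ≥0) * x⌋₊ + 1 ≤ (k + 1) ^ 2 := by nlinarith
    rw [gridIndex, min_eq_left h3]; push_cast; rfl
  have hlo : ∀ᶠ k : ℕ in atTop, x ≤ (gridIndex k x : ℝ≥0) / (k + 1) := by
    filter_upwards [hev] with k hk
    rw [hk, le_div_iff₀ (by positivity), mul_comm]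
    exact (Nat.lt_floor_add_one _).le
  have hhi : ∀ᶠ k : ℕ in atTop, (gridIndex k x : ℝ≥0) / (k + 1) ≤ x + 1 / ((k : ℝ≥0) + 1) := by
    filter_upwards [hev] with k hk
    rw [hk, add_div]
    gcongr
    rw [div_le_iff₀ (by positivity), mul_comm x]
    exact Nat.floor_le (by positivity)
  refine tendsto_nhdsWithin_iff.2 ⟨?_, hlo⟩
  refine tendsto_of_tendsto_of_tendsto_of_le_of_le' tendsto_const_nhds ?_ hlo hhi
  have : Tendsto (fun k : ℕ => 1 / ((k : ℝ≥0) + 1)) atTop (𝓝 0) :=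
    tendsto_one_div_add_atTop_nhds_zero_nat
  simpa using tendsto_const_nhds.add this

/-- Grid points approach each time from the right, so right-continuity gives convergence of the
sums; a bound along infinitely many grids survives the limit. -/
theorem lpSum_le_of_frequently_grid {p : ℝ} (hp : 1 ≤ p) {f : ℝ≥0 → ℝ}
    (hf : ∀ x, ContinuousWithinAt f (Set.Ici x) x) (m : ℕ) (t : ℕ → ℝ≥0) {c : ℝ}
    (h : ∃ᶠ k : ℕ in atTop, lpSum p m (fun j => f ((gridIndex k (t (j + 1)) : ℝ≥0) / (k + 1))
      - f ((gridIndex k (t j) : ℝ≥0) / (k + 1))) ≤ c) :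
    lpSum p m (fun j => f (t (j + 1)) - f (t j)) ≤ c := by
  have hp0 : 0 < p := by positivity
  refine le_of_tendsto_of_frequently ?_ h
  refine Tendsto.rpow_const (tendsto_finsetSum _ fun j _ => ?_) (Or.inr (by positivity))
  exact (((hf _).tendsto.comp (tendsto_gridIndex _)).sub
    ((hf _).tendsto.comp (tendsto_gridIndex _))).abs.rpow_const (Or.inr hp0.le)

/-! ### Replications of a counting process and Borel–Cantelli -/

section Replication

variable {Ω Ω' : Type*} [MeasurableSpace Ω] [MeasurableSpace Ω'] {μ : Measure Ω}
  {N : ℝ≥0 → Ω → ℕ} {μ' : Measure Ω'} {M : ℕ → ℝ≥0 → Ω' → ℕ} {B : ℝ}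

theorem ae_le_of_terminalValue_le (hB : 0 ≤ B)
    (hNB : ∀ᵐ ω ∂μ, terminalValue N ω ≤ ENNReal.ofReal B) :
    ∀ᵐ ω ∂μ, ∀ t, (N t ω : ℝ) ≤ B := by
  filter_upwards [hNB] with ω hω t
  have h1 := (le_iSup (fun t : ℝ≥0 => (N t ω : ℝ≥0∞)) t).trans hω
  rwa [← ENNReal.ofReal_natCast, ENNReal.ofReal_le_ofReal_iff hB] at h1

/-- Equality of laws transfers only events measurable for the product σ-algebra. The bound is
therefore transferred at natural times and extended to all times by monotonicity. -/
theorem IsReplicationSequence.ae_le (hM : IsReplicationSequence μ N μ' M)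
    (hN : ∀ᵐ ω ∂μ, ∀ t, (N t ω : ℝ) ≤ B) : ∀ᵐ ω ∂μ', ∀ i t, (M i t ω : ℝ) ≤ B := by
  refine ae_all_iff.2 fun i => ?_
  have hmeas : MeasurableSet {f : ℝ≥0 → ℕ | ∀ k : ℕ, (f k : ℝ) ≤ B} := by
    rw [Set.ofPred_forall]
    refine MeasurableSet.iInter fun k => measurableSet_le ?_ measurable_const
    exact measurable_from_top.comp (measurable_pi_apply (k : ℝ≥0))
  have h := (hM.identDistrib i).symm.ae_snd (p := fun f : ℝ≥0 → ℕ => ∀ k : ℕ, (f k : ℝ) ≤ B)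
    hmeas (hN.mono fun ω h k => h k)
  filter_upwards [h] with ω hω t
  obtain ⟨k, hk⟩ := exists_nat_ge t
  exact (Nat.cast_le.2 ((hM.isCountingProcess i).mono ω hk)).trans (hω k)

theorem IsReplicationSequence.integral_eq (hM : IsReplicationSequence μ N μ' M) (i : ℕ)
    (t : ℝ≥0) : ∫ ω, (M i t ω : ℝ) ∂μ' = meanFunction μ N t := by
  have h := (hM.identDistrib i).comp
    (u := fun f : ℝ≥0 → ℕ => (f t : ℝ)) (measurable_from_top.comp (measurable_pi_apply t))
  exact h.integral_eq

/-- Sampling the processes along an increasing sequence of times. -/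
theorem IsReplicationSequence.isMonotoneSample [IsProbabilityMeasure μ']
    (hM : IsReplicationSequence μ N μ' M) (hB : 0 ≤ B) (hN : ∀ᵐ ω ∂μ, ∀ t, (N t ω : ℝ) ≤ B)
    (τ : ℕ → ℝ≥0) (hτ : Monotone τ) :
    IsMonotoneSample μ' B (fun a => meanFunction μ N (τ a))
      (fun i ω a => min (M i (τ a) ω : ℝ) B) where
  measurable i := measurable_pi_lambda _ fun a =>
    (measurable_from_top.comp ((hM.isCountingProcess i).measurable (τ a))).min measurable_const
  indep := hM.indep.comp (fun _ (f : ℝ≥0 → ℕ) a => min (f (τ a) : ℝ) B) fun _ =>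
    measurable_pi_lambda _ fun a =>
      (measurable_from_top.comp (measurable_pi_apply (τ a))).min measurable_const
  mono i ω a b hab := min_le_min_right _ (Nat.cast_le.2 ((hM.isCountingProcess i).mono ω (hτ hab)))
  nonneg i ω a := le_min (Nat.cast_nonneg _) hB
  le i ω a := min_le_right _ _
  -- The truncation at `B` makes the bounds hold for every `ω`; almost surely it changes nothing, so
  -- the mean is unaffected.
  mean i a := by
    rw [← hM.integral_eq i]
    refine integral_congr_ae ?_
    filter_upwards [hM.ae_le hN] with ω hω
    exact min_eq_left (hω i _)

theorem IsCountingProcess.integrable [IsProbabilityMeasure μ] (hNc : IsCountingProcess N)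
    (hN : ∀ᵐ ω ∂μ, ∀ t, (N t ω : ℝ) ≤ B) (t : ℝ≥0) : Integrable (fun ω => (N t ω : ℝ)) μ :=
  Integrable.of_bound (measurable_from_top.comp (hNc.measurable t)).aestronglyMeasurable B
    (hN.mono fun ω h => by simpa using h t)

theorem IsCountingProcess.continuousWithinAt_cast (hNc : IsCountingProcess N) (ω : Ω) (t : ℝ≥0) :
    ContinuousWithinAt (fun s => (N s ω : ℝ)) (Set.Ici t) t :=
  (continuous_of_discreteTopology (f := fun n : ℕ => (n : ℝ))).continuousAt.comp_continuousWithinAt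
    (hNc.right_continuous ω t)

theorem IsCountingProcess.meanFunction_continuousWithinAt [IsProbabilityMeasure μ]
    (hNc : IsCountingProcess N) (hN : ∀ᵐ ω ∂μ, ∀ t, (N t ω : ℝ) ≤ B) (t : ℝ≥0) :
    ContinuousWithinAt (meanFunction μ N) (Set.Ici t) t :=
  continuousWithinAt_of_dominated (bound := fun _ => B)
    (.of_forall fun s => (hNc.integrable hN s).aestronglyMeasurable)
    (.of_forall fun s => hN.mono fun ω h => by simpa using h s) (integrable_const B)
    (.of_forall fun ω => hNc.continuousWithinAt_cast ω t)

theorem IsCountingProcess.meanFunction_mono [IsProbabilityMeasure μ]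
    (hNc : IsCountingProcess N) (hN : ∀ᵐ ω ∂μ, ∀ t, (N t ω : ℝ) ≤ B) :
    Monotone (meanFunction μ N) := fun _ _ h =>
  integral_mono (hNc.integrable hN _) (hNc.integrable hN _) fun ω =>
    Nat.cast_le.2 (hNc.mono ω h)

theorem IsCountingProcess.meanFunction_le [IsProbabilityMeasure μ]
    (hNc : IsCountingProcess N) (hN : ∀ᵐ ω ∂μ, ∀ t, (N t ω : ℝ) ≤ B) (t : ℝ≥0) :
    meanFunction μ N t ≤ B := by
  refine (integral_mono_ae (hNc.integrable hN t) (integrable_const B)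
    (hN.mono fun ω h => h t)).trans_eq ?_
  simp

theorem IsCountingProcess.meanFunction_zero (hNc : IsCountingProcess N) :
    meanFunction μ N 0 = 0 := by
  simp [meanFunction, hNc.zero]

theorem meanFunction_nonneg (t : ℝ≥0) : 0 ≤ meanFunction μ N t :=
  integral_nonneg fun _ => Nat.cast_nonneg _

theorem IsReplicationSequence.empiricalMean_sub_zero (hM : IsReplicationSequence μ N μ' M)
    (hNc : IsCountingProcess N) (n : ℕ) (ω : Ω') :
    (empiricalMean M n ω - meanFunction μ N) 0 = 0 := by
  simp [empiricalMean, hNc.meanFunction_zero, fun i => (hM.isCountingProcess i).zero]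

/-- A difference of two monotone functions with values in `[0, B]` has total variation at most `2 *
B`, and this bounds its `ℓ^p` sums. -/
theorem IsReplicationSequence.pVarNorm_lt_top [IsProbabilityMeasure μ]
    (hM : IsReplicationSequence μ N μ' M) (hNc : IsCountingProcess N) (hB : 0 ≤ B)
    (hN : ∀ᵐ ω ∂μ, ∀ t, (N t ω : ℝ) ≤ B) {p : ℝ} (hp : 1 ≤ p) {ω : Ω'}
    (hω : ∀ i t, (M i t ω : ℝ) ≤ B) (n : ℕ) :
    pVarNorm p (empiricalMean M n ω - meanFunction μ N) < ∞ := by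
  refine (pVarNorm_le hp (hM.empiricalMean_sub_zero hNc n ω) (c := 2 * B) (by positivity)
    fun m t ht => ?_).trans_lt ENNReal.ofReal_lt_top
  have hEm : Monotone (empiricalMean M n ω) := fun s u hsu =>
    mul_le_mul_of_nonneg_left (Finset.sum_le_sum fun i _ =>
      Nat.cast_le.2 ((hM.isCountingProcess i).mono ω hsu)) (by positivity)
  have hE0 : ∀ s, 0 ≤ empiricalMean M n ω s := fun s => by unfold empiricalMean; positivity
  have hEB : ∀ s, empiricalMean M n ω s ≤ B := fun s => by
    unfold empiricalMean
    have h1 : ∑ i ∈ Finset.range n, (M i s ω : ℝ) ≤ n * B :=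
      (Finset.sum_le_sum fun i _ => hω i s).trans_eq (by simp)
    rcases n.eq_zero_or_pos with rfl | hn
    · simpa using hB
    · rw [inv_mul_le_iff₀ (by exact_mod_cast hn)]; exact h1
  have hFm := hNc.meanFunction_mono hN
  refine (lpSum_le_sum_abs hp _ _).trans ?_
  have key : ∀ j, |(empiricalMean M n ω - meanFunction μ N) (t (j + 1))
      - (empiricalMean M n ω - meanFunction μ N) (t j)|
      ≤ (empiricalMean M n ω (t (j + 1)) + meanFunction μ N (t (j + 1)))
        - (empiricalMean M n ω (t j) + meanFunction μ N (t j)) := fun j => by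
    have h1 := hEm (ht (Nat.le_succ j))
    have h2 := hFm (ht (Nat.le_succ j))
    simp only [Pi.sub_apply, Nat.succ_eq_add_one] at *
    rw [abs_le]; constructor <;> linarith
  refine (Finset.sum_le_sum fun j _ => key j).trans ?_
  rw [Finset.sum_range_sub (fun j => empiricalMean M n ω (t j) + meanFunction μ N (t j))]
  have h3 : 0 ≤ meanFunction μ N (t 0) := meanFunction_nonneg _
  linarith [hE0 (t 0), hEB (t m), hNc.meanFunction_le hN (t m)]

/-- The constant `λ(p, B)`, up to a factor `2`. -/
noncomputable def rateConst (p B : ℝ) : ℝ := 4 * (meanConst p B + 1) + 8 * (B + 1)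

theorem rateConst_nonneg {p : ℝ} (hp : 1 ≤ p) (hp2 : p < 2) (hB : 0 < B) : 0 ≤ rateConst p B := by
  have h1 : (1 : ℝ) < 2 ^ (1 / p - 1 / 2) :=
    Real.one_lt_rpow (by norm_num) (exponent_pos hp hp2)
  have h2 : 0 ≤ meanConst p B := div_nonneg (by positivity) (by linarith)
  unfold rateConst; positivity

/-- Almost surely, the norm of `F_n - F` is eventually of the right order. -/
theorem IsReplicationSequence.ae_eventually_pVarNorm_le [IsProbabilityMeasure μ]
    [IsProbabilityMeasure μ'] (hM : IsReplicationSequence μ N μ' M) (hNc : IsCountingProcess N)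
    (hB : 0 < B) (hN : ∀ᵐ ω ∂μ, ∀ t, (N t ω : ℝ) ≤ B) {p : ℝ} (hp : 1 ≤ p) (hp2 : p < 2) :
    ∀ᵐ ω ∂μ', ∀ᶠ n : ℕ in atTop, pVarNorm p (empiricalMean M n ω - meanFunction μ N)
      ≤ ENNReal.ofReal (2 * rateConst p B * (n : ℝ) ^ ((1 - p) / p)) := by
  have hp0 : 0 < p := by positivity
  set ξ : ℕ → ℕ → Ω' → ℕ → ℝ := fun k i ω a => min (M i ((a : ℝ≥0) / (k + 1)) ω : ℝ) B with hξ
  set G : ℕ → ℕ → ℝ := fun k a => meanFunction μ N ((a : ℝ≥0) / (k + 1)) with hG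
  have hsample : ∀ k, IsMonotoneSample μ' B (G k) (ξ k) := fun k =>
    hM.isMonotoneSample hB.le hN (fun a => (a : ℝ≥0) / (k + 1)) fun a b hab => by
      have : (a : ℝ≥0) ≤ b := Nat.cast_le.2 hab
      exact div_le_div_of_nonneg_right this (by positivity)
  set A : ℕ → ℕ → Set Ω' := fun n k => {ω | ∃ (m : ℕ) (t : ℕ → ℕ), Monotone t ∧
      (∀ j, t j ≤ (k + 1) ^ 2) ∧ rateConst p B * (n : ℝ) ^ (1 / p)
        < lpSum p m (fun j => centredSum (G k) (ξ k) n ω (t (j + 1))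
          - centredSum (G k) (ξ k) n ω (t j))} with hA
  -- The limit inferior over grids: an outcome is bad only if all sufficiently fine grids fail. It
  -- is an increasing union of sets each contained in one `A n k₀`, so the grid-independent tail
  -- bound carries over without a union bound over `k`.
  set bad : ℕ → Set Ω' := fun n => if n = 0 then ∅ else ⋃ k₀, ⋂ k ≥ k₀, A n k with hbad
  have hbadle : ∀ n, μ' (bad n) ≤ ENNReal.ofReal (tailBound p B n) := by
    intro n
    rcases n.eq_zero_or_pos with rfl | hn
    · simp [hbad]
    · have hmono : Monotone fun k₀ => ⋂ k ≥ k₀, A n k := fun i j hij =>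
        Set.biInter_subset_biInter_left fun k hk => hij.trans hk
      simp only [hbad, hn.ne', if_false]
      rw [hmono.measure_iUnion]
      refine iSup_le fun k₀ => (measure_mono (Set.biInter_subset_of_mem (le_refl k₀))).trans ?_
      exact (hsample k₀).measure_increments_gt_le hB hp hp2 hn _
  have hsum : ∑' n, μ' (bad n) ≠ ∞ :=
    ne_top_of_le_ne_top (summable_tailBound hp hp2 hB).tsum_ofReal_ne_top
      (ENNReal.tsum_le_tsum hbadle)
  filter_upwards [ae_eventually_notMem hsum, hM.ae_le hN] with ω hω hωB
  filter_upwards [hω, eventually_gt_atTop 0] with n hn hn0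
  have hn' : (0 : ℝ) < n := by exact_mod_cast hn0
  simp only [hbad, hn0.ne', if_false, Set.mem_iUnion, Set.mem_iInter, not_exists, not_forall] at hn
  have hfreq : ∃ᶠ k in atTop, ω ∉ A n k := frequently_atTop.2 fun k₀ => by
    obtain ⟨k, hk, hk'⟩ := hn k₀
    exact ⟨k, hk, hk'⟩
  have hC := rateConst_nonneg hp hp2 hB
  set S : ℝ≥0 → ℝ := fun t => ∑ i ∈ Finset.range n, (M i t ω : ℝ) - n * meanFunction μ N t with hS
  have hSc : ∀ x, ContinuousWithinAt S (Set.Ici x) x := fun x =>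
    (tendsto_finsetSum _ fun i _ =>
      ((hM.isCountingProcess i).continuousWithinAt_cast ω x).tendsto).sub
      ((hNc.meanFunction_continuousWithinAt hN x).tendsto.const_mul _)
  have hSle : ∀ (m : ℕ) (t : ℕ → ℝ≥0), Monotone t →
      lpSum p m (fun j => S (t (j + 1)) - S (t j)) ≤ rateConst p B * (n : ℝ) ^ (1 / p) := by
    intro m t ht
    refine lpSum_le_of_frequently_grid hp hSc m t (hfreq.mono fun k hk => ?_)
    by_contra hcon
    refine hk ⟨m, fun j => gridIndex k (t j), (gridIndex_mono k).comp ht,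
      fun j => min_le_right _ _, (not_le.1 hcon).trans_eq ?_⟩
    have e : ∀ a : ℕ, centredSum (G k) (ξ k) n ω a = S ((a : ℝ≥0) / (k + 1)) := fun a => by
      simp only [centredSum, hξ, hS, hG]
      congr 1
      exact Finset.sum_congr rfl fun i _ => min_eq_left (hωB i _)
    simp only [e]
  have hrate : (n : ℝ)⁻¹ * (rateConst p B * (n : ℝ) ^ (1 / p))
      = rateConst p B * (n : ℝ) ^ ((1 - p) / p) := by
    rw [← Real.rpow_neg_one, mul_left_comm, ← Real.rpow_add hn']
    congr 2; field_simp; ring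
  rw [mul_assoc, ← hrate]
  refine pVarNorm_le hp (hM.empiricalMean_sub_zero hNc n ω) (by positivity) fun m t ht => ?_
  have hscale : ∀ x : ℕ → ℝ, lpSum p m (fun j => (n : ℝ)⁻¹ * x j) = (n : ℝ)⁻¹ * lpSum p m x := by
    intro x
    have h0 : 0 ≤ ∑ j ∈ Finset.range m, |x j| ^ p := Finset.sum_nonneg fun _ _ => by positivity
    have hi : 0 ≤ (n : ℝ)⁻¹ := by positivity
    simp only [lpSum, abs_mul, abs_of_nonneg hi, Real.mul_rpow hi (abs_nonneg _)]
    rw [← Finset.mul_sum, Real.mul_rpow (by positivity) h0, ← Real.rpow_mul hi,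
      mul_one_div_cancel hp0.ne', Real.rpow_one]
  have e : (fun j => (empiricalMean M n ω - meanFunction μ N) (t (j + 1))
      - (empiricalMean M n ω - meanFunction μ N) (t j))
      = fun j => (n : ℝ)⁻¹ * (S (t (j + 1)) - S (t j)) := by
    funext j
    simp only [Pi.sub_apply, empiricalMean, hS]
    field_simp
  rw [e, hscale]
  exact mul_le_mul_of_nonneg_left (hSle m t ht) (by positivity)

end Replication

end CountingProcess

theorem mainTheorem3 (p : ℝ) (hp1 : 1 ≤ p) (hp2 : p < 2) (B : ℝ) (hB : 0 < B) :
    ∃ lam : ℝ≥0,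
      ∀ (Ω : Type*) [MeasurableSpace Ω] (μ : Measure Ω) [IsProbabilityMeasure μ]
        (N : ℝ≥0 → Ω → ℕ), CountingProcess.IsCountingProcess N →
        (∀ᵐ ω ∂μ, CountingProcess.terminalValue N ω ≤ ENNReal.ofReal B) →
      ∀ (Ω' : Type*) [MeasurableSpace Ω'] (μ' : Measure Ω') [IsProbabilityMeasure μ']
        (M : ℕ → ℝ≥0 → Ω' → ℕ), CountingProcess.IsReplicationSequence μ N μ' M →
      ∀ᵐ ω ∂μ',
        (∀ n : ℕ, CountingProcess.pVarNorm p
          (CountingProcess.empiricalMean M n ω - CountingProcess.meanFunction μ N) < ∞) ∧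
        limsup (fun n : ℕ => (n : ℝ≥0∞) ^ ((p - 1) / p) * CountingProcess.pVarNorm p
          (CountingProcess.empiricalMean M n ω - CountingProcess.meanFunction μ N)) atTop
            ≤ (lam : ℝ≥0∞) ∧
        (fun n : ℕ => (CountingProcess.pVarNorm p
          (CountingProcess.empiricalMean M n ω - CountingProcess.meanFunction μ N)).toReal)
            =O[atTop] (fun n : ℕ => (n : ℝ) ^ ((1 - p) / p)) := by
  -- The factor 2 is that of `pVarNorm_le`.
  refine ⟨(2 * CountingProcess.rateConst p B).toNNReal, ?_⟩
  intro Ω _ μ _ N hNc hNB Ω' _ μ' _ M hM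
  have hN := CountingProcess.ae_le_of_terminalValue_le hB.le hNB
  have hC := CountingProcess.rateConst_nonneg hp1 hp2 hB
  filter_upwards [hM.ae_le hN, hM.ae_eventually_pVarNorm_le hNc hB hN hp1 hp2] with ω hω hev
  refine ⟨hM.pVarNorm_lt_top hNc hB.le hN hp1 hω, ?_, ?_⟩
  · refine limsup_le_of_le (by isBoundedDefault) ?_
    filter_upwards [hev, eventually_gt_atTop 0] with n hn hn0
    have hn' : (0 : ℝ) < n := by exact_mod_cast hn0
    refine (mul_le_mul_right hn _).trans_eq ?_
    rw [← ENNReal.ofReal_natCast, ENNReal.ofReal_rpow_of_pos hn',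
      ← ENNReal.ofReal_mul (by positivity), mul_left_comm, ← Real.rpow_add hn',
      show (p - 1) / p + (1 - p) / p = 0 by ring, Real.rpow_zero, mul_one]
    rfl
  · refine IsBigO.of_bound (2 * CountingProcess.rateConst p B) ?_
    filter_upwards [hev] with n hn
    rw [Real.norm_of_nonneg ENNReal.toReal_nonneg, Real.norm_of_nonneg (by positivity)]
    exact ENNReal.toReal_le_of_le_ofReal (by positivity) hn
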